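/- Let $G$ be a finite metacyclic group, i.e. a finite group having a cyclic normal subgroup $N$ with $G/N$ cyclic. Call $G$: - *quadratic rational* if for every irreducible complex character $\chi$ of $G$ the field $\mathbb{Q}(\chi)=\mathbb{Q}(\chi(g) : g\in G)$ is either $\mathbb{Q}$ or a quadratic extension of $\mathbb{Q}$; - *semi-rational* if for every $x\in G$ there is an integer $m_x$ such that every generator of $\langle x\rangle$ is conjugate in $G$ to $x$ or to $x^{m_x}$; - *uniformly semi-rational* if there is a single integer $m$ such that, for every $x\in G$, every generator of $\langle x\rangle$ is conjugate in $G$ to $x$ or to $x^{m}$; - *quadratic semi-rational* if it is both semi-rational and quadratic rational. Then $G$ is quadratic rational if and only if it is uniformly semi-rational. Consequently, the following are equivalent: (i) $G$ is uniformly semi-rational; (ii) $G$ is quadratic rational; (iii) $G$ is quadratic semi-rational. -/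

import Mathlib

/-- A group is metacyclic if it has a cyclic normal subgroup with cyclic quotient. -/
def IsMetacyclicGroup (G : Type*) [Group G] : Prop :=
  ∃ (N : Subgroup G) (_ : N.Normal), IsCyclic N ∧ IsCyclic (G ⧸ N)

/-- `χ : G → ℂ` is the character of an irreducible (finite-dimensional) complex
representation of `G`, that is, `χ ∈ Irr(G)`. Every such representation can be realised
on a space in `Type`, so the choice of universe is immaterial. -/
def IsIrreducibleCharacter {G : Type*} [Group G] (χ : G → ℂ) : Prop :=
  ∃ (V : Type) (_ : AddCommGroup V) (_ : Module ℂ V) (_ : FiniteDimensional ℂ V)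
    (ρ : Representation ℂ G V), ρ.IsIrreducible ∧ ∀ g : G, χ g = ρ.character g

/-- The field `ℚ(χ)` generated over `ℚ` by the values of `χ`. -/
noncomputable def characterField {G : Type*} (χ : G → ℂ) : IntermediateField ℚ ℂ :=
  IntermediateField.adjoin ℚ (Set.range χ)

/-- `G` is quadratic rational: for every irreducible complex character `χ`, the field `ℚ(χ)`
is `ℚ` or a quadratic extension of `ℚ`. -/
def IsQuadraticRationalGroup (G : Type*) [Group G] : Prop :=
  ∀ χ : G → ℂ, IsIrreducibleCharacter χ →
    characterField χ = ⊥ ∨ Module.finrank ℚ (characterField χ) = 2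

/-- Every generator of `⟨x⟩` lies in the union of the conjugacy classes of `x` and `x ^ m`. -/
def IsSemiRationalElementWith {G : Type*} [Group G] (m : ℤ) (x : G) : Prop :=
  ∀ y : G, Subgroup.zpowers y = Subgroup.zpowers x → IsConj x y ∨ IsConj (x ^ m) y

/-- `G` is semi-rational: for every `x`, the generators of `⟨x⟩` lie in at most two conjugacy
classes, that of `x` and that of a power of `x` (which may depend on `x`). -/
def IsSemiRationalGroup (G : Type*) [Group G] : Prop :=
  ∀ x : G, ∃ m : ℤ, IsSemiRationalElementWith m x

/-- `G` is uniformly semi-rational: a single exponent `m` works for all elements. -/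
def IsUniformlySemiRationalGroup (G : Type*) [Group G] : Prop :=
  ∃ m : ℤ, ∀ x : G, IsSemiRationalElementWith m x

/-- `G` is quadratic semi-rational: both semi-rational and quadratic rational. -/
def IsQuadraticSemiRationalGroup (G : Type*) [Group G] : Prop :=
  IsSemiRationalGroup G ∧ IsQuadraticRationalGroup G

/-! Automorphisms of ℂ send an irreducible character χ to χ^s, where χ^s(x) = χ(x^s) and s is prime
to |G|. Since ℚ(χ) has as many embeddings in ℂ as its degree, G is quadratic rational exactly when
every χ has at most two conjugates χ^s.

If one exponent r serves all x, it can be taken prime to |G|. Then χ^s + χ^(sr) = χ + χ^r, and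
orthonormality of irreducible characters leaves at most two conjugates. Conversely, if every χ^s is
χ or χ^r with r independent of χ, the same identity over all χ compares class sums and makes x^s
conjugate to x or to x^r (`isUniformlySemiRationalGroup_of_forall_character`).

It remains to find, in a quadratic rational metacyclic group, one r that moves every χ not fixed by
all s. Let ⟨a⟩ be normal, G = ⟨a⟩⟨b⟩, and S the set of s with a^s conjugate to a. A character lying
over a faithful character of ⟨a⟩ shows that S has index at most 2. An irreducible χ vanishes at x
unless ρ(x) commutes with ρ(a), and then x = a^i b^j acts as a scalar times ρ(a^i). Such scalars
have order 1, 2, 3, 4 or 6. If r fixes χ but no scalar of order 3 or 4, only ±1 occur, so S fixes χ;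
if moreover r lies outside S, or S is everything, then χ is fixed by all s (`eq_or_eq_of_exponent`).

The choice r = -1 works unless -1 lies in S and S is proper. Then r = ±p with p outside S, the sign
being chosen modulo 3 or modulo 4. One modulus is enough, because scalars of orders 3 and 4 cannot
both occur (`false_of_orderOf_scalar`): a twist would give a scalar of order 12. -/

/-! ### Automorphisms of ℂ and roots of unity -/

open Cardinal in
/-- Uncountable algebraically closed extensions of the same cardinality of a countable field are
isomorphic over that field. -/
theorem exists_ringEquiv_comp_algebraMap {K L M : Type} [Field K] [Field L] [Field M]
    [Algebra K L] [Algebra K M] [IsAlgClosed L] [IsAlgClosed M] (hK : #K ≤ ℵ₀) (hL : ℵ₀ < #L)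
    (hLM : #L = #M) : ∃ τ : L ≃+* M, ∀ x, τ (algebraMap K L x) = algebraMap K M x := by
  obtain ⟨s, hs⟩ := exists_isTranscendenceBasis K L
  obtain ⟨t, ht⟩ := exists_isTranscendenceBasis K M
  have hs' := IsAlgClosed.cardinal_eq_cardinal_transcendence_basis_of_aleph0_lt' _ hs hK hL
  have ht' := IsAlgClosed.cardinal_eq_cardinal_transcendence_basis_of_aleph0_lt' _ ht hK (hLM ▸ hL)
  obtain ⟨e⟩ := Cardinal.eq.1 (hs'.symm.trans (hLM.trans ht'))
  let := IsAlgClosed.isAlgClosure_of_transcendence_basis _ hs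
  let := IsAlgClosed.isAlgClosure_of_transcendence_basis _ ht
  let f := hs.1.aevalEquiv.symm.trans ((MvPolynomial.renameEquiv K e).trans ht.1.aevalEquiv)
  refine ⟨IsAlgClosure.equivOfEquiv L M f.toRingEquiv, fun x => ?_⟩
  have := IsAlgClosure.equivOfEquiv_algebraMap L M f.toRingEquiv (algebraMap K _ x)
  have h2 : f.toRingEquiv (algebraMap K _ x) = algebraMap K _ x := f.commutes x
  rw [h2] at this
  exact this

/-- Any two embeddings of a countable field in `ℂ` differ by an automorphism of `ℂ`. -/
theorem exists_complex_ringEquiv_comp {K : Type} [Field K] [Countable K] (i φ : K →+* ℂ) :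
    ∃ τ : ℂ ≃+* ℂ, ∀ x, τ (i x) = φ x :=
  @exists_ringEquiv_comp_algebraMap K ℂ ℂ _ _ _ i.toAlgebra φ.toAlgebra _ _
    (Cardinal.mk_le_aleph0_iff.2 inferInstance)
    (by rw [Cardinal.mk_complex]; exact Cardinal.aleph0_lt_continuum) rfl

/-- Raising roots of unity to a coprime power extends to an automorphism of `ℂ`. -/
theorem exists_complex_ringEquiv_zpow {e : ℕ} (he : e ≠ 0) {r : ℤ} (hr : IsCoprime r e) :
    ∃ τ : ℂ ≃+* ℂ, ∀ z : ℂ, z ^ e = 1 → τ z = z ^ r := by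
  have : NeZero e := ⟨he⟩
  have hζ := Complex.isPrimitiveRoot_exp e he
  set ζ := Complex.exp (2 * Real.pi * Complex.I / e)
  have hζr : IsPrimitiveRoot (ζ ^ r) e := hζ.zpow_of_gcd_eq_one r (Int.isCoprime_iff_gcd_eq_one.1 hr)
  let P := Polynomial.cyclotomic e ℚ
  have : Fact (Irreducible P) := ⟨Polynomial.cyclotomic.irreducible_rat (Nat.pos_of_ne_zero he)⟩
  have hroot : ∀ z : ℂ, IsPrimitiveRoot z e → P.eval₂ (algebraMap ℚ ℂ) z = 0 := fun z hz => by
    have := (Polynomial.isRoot_cyclotomic_iff (R := ℂ)).2 hz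
    rwa [← Polynomial.map_cyclotomic e (algebraMap ℚ ℂ), Polynomial.IsRoot, Polynomial.eval_map]
      at this
  have : Countable (AdjoinRoot P) := by
    have : Countable (Polynomial ℚ) := Cardinal.mk_le_aleph0_iff.1 (by
      simp)
    exact AdjoinRoot.mk_surjective.countable
  -- The two embeddings of the cyclotomic field send the adjoined root to ζ and to ζ ^ r.
  obtain ⟨τ, hτ⟩ := exists_complex_ringEquiv_comp
    (AdjoinRoot.lift (algebraMap ℚ ℂ) ζ (hroot _ hζ)) (AdjoinRoot.lift _ _ (hroot _ hζr))
  have h1 : τ ζ = ζ ^ r := by simpa using hτ (AdjoinRoot.root P)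
  refine ⟨τ, fun z hz => ?_⟩
  obtain ⟨k, -, rfl⟩ := hζ.eq_pow_of_pow_eq_one hz
  rw [map_pow, h1, ← zpow_natCast, ← zpow_natCast, ← zpow_mul, ← zpow_mul, mul_comm]

/-- Every automorphism of `ℂ` raises roots of unity of a given order to a coprime power. -/
theorem exists_zpow_of_complex_ringEquiv {e : ℕ} (he : e ≠ 0) (τ : ℂ ≃+* ℂ) :
    ∃ r : ℤ, IsCoprime r e ∧ ∀ z : ℂ, z ^ e = 1 → τ z = z ^ r := by
  have : NeZero e := ⟨he⟩
  have hζ := Complex.isPrimitiveRoot_exp e he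
  set ζ := Complex.exp (2 * Real.pi * Complex.I / e)
  have hτ : IsPrimitiveRoot (τ ζ) e := hζ.map_of_injective τ.injective
  obtain ⟨r, -, hr⟩ := hζ.eq_pow_of_pow_eq_one hτ.pow_eq_one
  refine ⟨r, ?_, fun z hz => ?_⟩
  · rw [Nat.isCoprime_iff_coprime]
    exact (hζ.pow_iff_coprime (Nat.pos_of_ne_zero he) r).1 (hr ▸ hτ)
  · obtain ⟨k, -, rfl⟩ := hζ.eq_pow_of_pow_eq_one hz
    rw [map_pow, ← hr, ← pow_mul, mul_comm, pow_mul, zpow_natCast]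

/-! ### Eigenvalues, Galois conjugation and complete reducibility of representations -/

theorem Module.End.isInternal_eigenspace_of_pow_eq_one {V : Type*} [AddCommGroup V] [Module ℂ V]
    [FiniteDimensional ℂ V] {f : Module.End ℂ V} {e : ℕ} (he : e ≠ 0) (hf : f ^ e = 1) :
    DirectSum.IsInternal f.eigenspace := by
  have hss : f.IsSemisimple := by
    refine Module.End.isSemisimple_of_squarefree_aeval_eq_zero
      (p := (Polynomial.X ^ e - 1 : Polynomial ℂ)) ?_ (by simp [hf])
    exact (Polynomial.separable_X_pow_sub_C (1 : ℂ) (by exact_mod_cast he) one_ne_zero).squarefree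
  refine DirectSum.isInternal_submodule_of_iSupIndep_of_iSup_eq_top f.eigenspaces_iSupIndep ?_
  rw [← f.iSup_maxGenEigenspace_eq_top]
  exact iSup_congr fun μ => (hss.isFinitelySemisimple.maxGenEigenspace_eq_eigenspace μ).symm


namespace Representation

variable {G V : Type*} [Group G] [AddCommGroup V] [Module ℂ V]

theorem pow_natCard_eq_one [Finite G] (ρ : Representation ℂ G V) (x : G) :
    ρ x ^ Nat.card G = 1 := by
  rw [← map_pow, pow_card_eq_one', map_one]

theorem apply_zpow_of_eigenvector (ρ : Representation ℂ G V) {x : G} {μ : ℂ} {v : V}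
    (hμ : μ ≠ 0) (hv : ρ x v = μ • v) (r : ℤ) : ρ (x ^ r) v = μ ^ r • v := by
  have hinv : ρ x⁻¹ v = μ⁻¹ • v := by
    rw [eq_inv_smul_iff₀ hμ, ← map_smul, ← hv, ← Module.End.mul_apply, ← map_mul]; simp
  induction r with
  | zero => simp
  | succ n ih => rw [zpow_add_one, map_mul, Module.End.mul_apply, hv, map_smul, ih, smul_smul,
      zpow_add_one₀ hμ, mul_comm]
  | pred n ih => rw [zpow_sub_one, map_mul, Module.End.mul_apply, hinv, map_smul, ih, smul_smul,
      zpow_sub_one₀ hμ, mul_comm]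

theorem pow_natCard_eq_one_of_eigenvector [Finite G] (ρ : Representation ℂ G V) {x : G} {μ : ℂ}
    {v : V} (hv0 : v ≠ 0) (hv : ρ x v = μ • v) : μ ^ Nat.card G = 1 := by
  have h : ∀ n : ℕ, (ρ x ^ n) v = μ ^ n • v := fun n => by
    induction n with
    | zero => simp
    | succ n ih => rw [pow_succ, Module.End.mul_apply, hv, map_smul, ih, smul_smul, pow_succ,
        mul_comm]
  have := h (Nat.card G)
  rw [pow_natCard_eq_one, Module.End.one_apply] at this
  by_contra hne
  exact (sub_ne_zero.2 hne) ((smul_eq_zero.1 (by rw [sub_smul, ← this]; simp :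
    (μ ^ Nat.card G - 1) • v = 0)).resolve_right hv0)

theorem IsIrreducible.nontrivial' (ρ : Representation ℂ G V) [ρ.IsIrreducible] : Nontrivial V := by
  by_contra h
  rw [not_nontrivial_iff_subsingleton] at h
  exact bot_ne_top (α := Subrepresentation ρ)
    (Subrepresentation.toSubmodule_injective (Subsingleton.elim _ _))

theorem isIrreducible_of_forall [Nontrivial V] (ρ : Representation ℂ G V)
    (h : ∀ W : Submodule ℂ V, (∀ g, ∀ v ∈ W, ρ g v ∈ W) → W = ⊥ ∨ W = ⊤) : ρ.IsIrreducible where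
  exists_pair_ne := ⟨⊥, ⊤, fun h => bot_ne_top (α := Submodule ℂ V)
    (congrArg Subrepresentation.toSubmodule h)⟩
  eq_bot_or_eq_top W := (h W.toSubmodule W.apply_mem_toSubmodule).imp
    (fun h => Subrepresentation.toSubmodule_injective h)
    (fun h => Subrepresentation.toSubmodule_injective h)

theorem IsIrreducible.eq_bot_or_eq_top_of_forall (ρ : Representation ℂ G V) [ρ.IsIrreducible]
    (W : Submodule ℂ V) (h : ∀ g, ∀ v ∈ W, ρ g v ∈ W) : W = ⊥ ∨ W = ⊤ :=
  (eq_bot_or_eq_top (⟨W, h⟩ : Subrepresentation ρ)).imp (congrArg Subrepresentation.toSubmodule)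
    (congrArg Subrepresentation.toSubmodule)

/-- The twist of a representation by a linear character. -/
noncomputable def twist (ρ : Representation ℂ G V) (θ : G →* ℂˣ) : Representation ℂ G V where
  toFun g := (θ g : ℂ) • ρ g
  map_one' := by simp
  map_mul' g h := by rw [map_mul, map_mul, smul_mul_smul_comm, Units.val_mul]

theorem twist_apply (ρ : Representation ℂ G V) (θ : G →* ℂˣ) (g : G) :
    ρ.twist θ g = (θ g : ℂ) • ρ g := rfl

instance (ρ : Representation ℂ G V) [ρ.IsIrreducible] (θ : G →* ℂˣ) :
    (ρ.twist θ).IsIrreducible := by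
  have := IsIrreducible.nontrivial' ρ
  refine isIrreducible_of_forall _ fun W hW =>
    IsIrreducible.eq_bot_or_eq_top_of_forall ρ W fun g v hv => ?_
  have h := W.smul_mem ((θ g : ℂ)⁻¹) (hW g v hv)
  rwa [twist_apply, LinearMap.smul_apply, inv_smul_smul₀ (θ g).ne_zero] at h

variable [FiniteDimensional ℂ V]

/-- The eigenspaces of ρ x serve for all its powers, so one list of roots of unity and
multiplicities computes every χ(x ^ r). The Galois action and integrality of character values
follow. -/
theorem exists_character_zpow_eq_sum [Finite G] (ρ : Representation ℂ G V) (x : G) :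
    ∃ (s : Finset ℂ) (m : ℂ → ℕ), (∀ μ ∈ s, μ ^ Nat.card G = 1) ∧
      ∀ r : ℤ, ρ.character (x ^ r) = ∑ μ ∈ s, μ ^ r * (m μ : ℂ) := by
  have hint := Module.End.isInternal_eigenspace_of_pow_eq_one Nat.card_pos.ne'
    (ρ.pow_natCard_eq_one x)
  have hfin : {μ | Module.End.eigenspace (ρ x) μ ≠ ⊥}.Finite :=
    WellFoundedGT.finite_ne_bot_of_iSupIndep hint.submodule_iSupIndep
  have hroot : ∀ μ v, v ∈ Module.End.eigenspace (ρ x) μ → v ≠ 0 → μ ^ Nat.card G = 1 :=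
    fun μ v hv hv0 => ρ.pow_natCard_eq_one_of_eigenvector hv0 (Module.End.mem_eigenspace_iff.1 hv)
  have happ : ∀ (s : ℤ) μ v, v ∈ Module.End.eigenspace (ρ x) μ → ρ (x ^ s) v = μ ^ s • v :=
    fun s μ v hv => by
      by_cases hv0 : v = 0
      · simp [hv0]
      · refine ρ.apply_zpow_of_eigenvector (fun h => ?_) (Module.End.mem_eigenspace_iff.1 hv) s
        have := hroot μ v hv hv0
        rw [h, zero_pow Nat.card_pos.ne'] at this
        exact zero_ne_one this
  refine ⟨hfin.toFinset, fun μ => Module.finrank ℂ (Module.End.eigenspace (ρ x) μ),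
    fun μ hμ => ?_, fun s => ?_⟩
  · obtain ⟨v, hv, hv0⟩ := (Submodule.ne_bot_iff _).1 (hfin.mem_toFinset.1 hμ)
    exact hroot μ v hv hv0
  · have hmaps : ∀ μ, Set.MapsTo (ρ (x ^ s)) (Module.End.eigenspace (ρ x) μ)
        (Module.End.eigenspace (ρ x) μ) :=
      fun μ v hv => by rw [happ s μ v hv]; exact Submodule.smul_mem _ _ hv
    rw [character, LinearMap.trace_eq_sum_trace_restrict' hint hfin hmaps]
    refine Finset.sum_congr rfl fun μ _ => ?_
    have : (ρ (x ^ s)).restrict (hmaps μ) = μ ^ s • LinearMap.id := by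
      ext v; exact happ s μ v v.2
    rw [this, map_smul, LinearMap.trace_id, smul_eq_mul]

/-- The Galois action on character values. -/
theorem ringEquiv_character [Finite G] (ρ : Representation ℂ G V) {τ : ℂ ≃+* ℂ} {r : ℤ}
    (hτ : ∀ z : ℂ, z ^ Nat.card G = 1 → τ z = z ^ r) (x : G) :
    τ (ρ.character x) = ρ.character (x ^ r) := by
  obtain ⟨s, m, hs, hm⟩ := ρ.exists_character_zpow_eq_sum x
  have h1 := hm 1
  rw [zpow_one] at h1
  rw [h1, hm r, map_sum]
  refine Finset.sum_congr rfl fun μ hμ => ?_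
  rw [map_mul, map_natCast, zpow_one, hτ μ (hs μ hμ)]

theorem isIntegral_character [Finite G] (ρ : Representation ℂ G V) (x : G) :
    IsIntegral ℚ (ρ.character x) := by
  obtain ⟨s, m, hs, hm⟩ := ρ.exists_character_zpow_eq_sum x
  have h1 := hm 1
  rw [zpow_one] at h1
  rw [h1]
  refine IsIntegral.sum _ fun μ hμ => IsIntegral.mul ?_ (isIntegral_natCast _)
  rw [zpow_one]
  exact IsIntegral.of_pow Nat.card_pos (by rw [hs μ hμ]; exact isIntegral_one)

/-- Schur's lemma. -/
theorem IsIrreducible.exists_eq_smul_one (ρ : Representation ℂ G V) [ρ.IsIrreducible]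
    (f : Module.End ℂ V) (hf : ∀ g, f * ρ g = ρ g * f) : ∃ c : ℂ, f = c • 1 := by
  obtain ⟨c, hc⟩ := (IsIrreducible.algebraMap_intertwiningMap_bijective_of_isAlgClosed
    (ρ := ρ)).2 ⟨f, hf⟩
  exact ⟨c, (congrArg IntertwiningMap.toLinearMap hc).symm⟩

/-- The Galois conjugate of a representation, on the coordinate space. -/
noncomputable def galoisConj (ρ : Representation ℂ G V) (τ : ℂ ≃+* ℂ) :
    Representation ℂ G (Fin (Module.finrank ℂ V) → ℂ) :=
  (Matrix.toLinAlgEquiv' : Matrix _ _ ℂ ≃ₐ[ℂ] _).toMonoidHom.comp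
    ((τ.toRingHom.mapMatrix.toMonoidHom).comp
      ((LinearMap.toMatrixAlgEquiv (Module.finBasis ℂ V)).toMonoidHom.comp ρ))

theorem character_galoisConj (ρ : Representation ℂ G V) (τ : ℂ ≃+* ℂ) (g : G) :
    (ρ.galoisConj τ).character g = τ (ρ.character g) := by
  rw [character, character, LinearMap.trace_eq_matrix_trace ℂ (Module.finBasis ℂ V),
    Matrix.trace, map_sum]
  exact Matrix.trace_toLin'_eq _

/-- Taking coordinates and applying τ is a τ-semilinear bijection `S` that intertwines the two
actions, so invariant subspaces pull back to invariant subspaces. -/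
instance (ρ : Representation ℂ G V) [ρ.IsIrreducible] (τ : ℂ ≃+* ℂ) :
    (ρ.galoisConj τ).IsIrreducible := by
  have hV := IsIrreducible.nontrivial' ρ
  have : Nonempty (Fin (Module.finrank ℂ V)) := Fin.pos_iff_nonempty.1 Module.finrank_pos
  let b := Module.finBasis ℂ V
  let S : V → Fin (Module.finrank ℂ V) → ℂ := fun v i => τ (b.repr v i)
  have hadd : ∀ v w, S (v + w) = S v + S w := fun v w => by ext i; simp [S]
  have hsmul : ∀ (c : ℂ) v, S (c • v) = τ c • S v := fun c v => by ext i; simp [S]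
  have hsurj : ∀ w, ∃ v, S v = w := fun w =>
    ⟨b.equivFun.symm fun i => τ.symm (w i), by
      ext i
      change τ (b.equivFun (b.equivFun.symm _) i) = _
      rw [LinearEquiv.apply_symm_apply, RingEquiv.apply_symm_apply]⟩
  have hinj : ∀ v, S v = 0 → v = 0 := fun v hv => by
    refine b.ext_elem fun i => ?_
    have : τ (b.repr v i) = 0 := congrFun hv i
    simpa using this
  have hcomm : ∀ g v, S (ρ g v) = ρ.galoisConj τ g (S v) := fun g v => by
    ext i
    have h1 : ρ.galoisConj τ g (S v) i =
        ∑ j, τ (LinearMap.toMatrix b b (ρ g) i j) * τ (b.repr v j) := rfl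
    rw [h1]
    simp only [← map_mul, ← map_sum, S]
    rw [← LinearMap.toMatrix_mulVec_repr b b]
    rfl
  refine isIrreducible_of_forall _ fun W' hW' => ?_
  let W : Submodule ℂ V :=
    { carrier := {v | S v ∈ W'}
      add_mem' := fun {v w} hv hw => by
        rw [Set.mem_ofPred_eq, hadd]; exact W'.add_mem hv hw
      zero_mem' := by
        have : S 0 = 0 := by ext i; simp [S]
        rw [Set.mem_ofPred_eq, this]; exact W'.zero_mem
      smul_mem' := fun c v hv => by
        rw [Set.mem_ofPred_eq, hsmul]; exact W'.smul_mem _ hv }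
  have hW : ∀ g, ∀ v ∈ W, ρ g v ∈ W := fun g v hv => by
    change S (ρ g v) ∈ W'
    rw [hcomm]; exact hW' g _ hv
  rcases IsIrreducible.eq_bot_or_eq_top_of_forall ρ W hW with h | h
  · refine Or.inl ((Submodule.eq_bot_iff _).2 fun w hw => ?_)
    obtain ⟨v, rfl⟩ := hsurj w
    have : v ∈ W := hw
    rw [h, Submodule.mem_bot] at this
    rw [this]; ext i; simp [S]
  · refine Or.inr ((Submodule.eq_top_iff').2 fun w => ?_)
    obtain ⟨v, rfl⟩ := hsurj w
    have : v ∈ W := h ▸ Submodule.mem_top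
    exact this

/-- Induction on dimension: a reducible representation is the sum of two proper invariant subspaces
by Maschke. -/
theorem sum_smul_eq_zero_of_isIrreducible {G : Type*} [Group G] [Fintype G] (z : G → ℂ)
    (hz : ∀ (V : Type) (_ : AddCommGroup V) (_ : Module ℂ V) (_ : FiniteDimensional ℂ V)
      (ρ : Representation ℂ G V), ρ.IsIrreducible → ∑ g, z g • ρ g = 0) (n : ℕ) {V : Type*}
    [AddCommGroup V] [Module ℂ V] [FiniteDimensional ℂ V] (ρ : Representation ℂ G V)
    (hn : Module.finrank ℂ V = n) : ∑ g, z g • ρ g = 0 := by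
  induction n using Nat.strong_induction_on generalizing V with
  | _ n ih =>
    have hsub : ∀ W : Subrepresentation ρ, W.toSubmodule ≠ ⊤ →
        ∀ w ∈ W.toSubmodule, (∑ g, z g • ρ g) w = 0 := fun W hW w hw => by
      have h := ih _ (hn ▸ Submodule.finrank_lt hW) W.toRepresentation rfl
      have h1 := congrArg (fun f => ((f ⟨w, hw⟩ : W.toSubmodule) : V)) h
      simpa [Subrepresentation.toRepresentation] using h1
    by_cases hirr : ρ.IsIrreducible
    -- Conjugation by the identity only moves the representation to coordinate space, which lies in
    -- `Type` as `hz` demands.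
    · have h0 := hz _ _ _ inferInstance (ρ.galoisConj (RingEquiv.refl ℂ)) inferInstance
      refine (LinearMap.toMatrixAlgEquiv (Module.finBasis ℂ V)).injective
        ((Matrix.toLinAlgEquiv').injective ?_)
      rw [map_zero, map_zero, ← h0, map_sum, map_sum]
      refine Finset.sum_congr rfl fun g _ => ?_
      rw [map_smul, map_smul]
      rfl
    · rcases subsingleton_or_nontrivial V with hV | hV
      · exact Subsingleton.elim _ _
      have : ∃ W : Submodule ℂ V, (∀ g, ∀ v ∈ W, ρ g v ∈ W) ∧ W ≠ ⊥ ∧ W ≠ ⊤ := by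
        by_contra! hcon
        exact hirr (isIrreducible_of_forall ρ fun W hW => or_iff_not_imp_left.2 (hcon W hW))
      obtain ⟨W, hW, hbot, htop⟩ := this
      let W₁ : Subrepresentation ρ := ⟨W, hW⟩
      obtain ⟨W₂, hW₂⟩ := exists_isCompl W₁
      have hsup : W ⊔ W₂.toSubmodule = ⊤ :=
        congrArg Subrepresentation.toSubmodule hW₂.sup_eq_top
      have hinf : W ⊓ W₂.toSubmodule = ⊥ :=
        congrArg Subrepresentation.toSubmodule hW₂.inf_eq_bot
      ext v
      obtain ⟨w, hw, w', hw', rfl⟩ := Submodule.mem_sup.1 (hsup ▸ Submodule.mem_top : v ∈ _)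
      rw [map_add, hsub W₁ htop w hw, hsub W₂ (fun h => hbot (by rwa [h, inf_top_eq] at hinf)) w' hw']
      simp

/-- A nonzero element of the group algebra acts nontrivially on some irreducible
representation. -/
theorem exists_isIrreducible_sum_ne_zero {G : Type*} [Group G] [Fintype G] (z : G → ℂ)
    (hz : z ≠ 0) : ∃ (V : Type) (_ : AddCommGroup V) (_ : Module ℂ V) (_ : FiniteDimensional ℂ V)
      (ρ : Representation ℂ G V), ρ.IsIrreducible ∧ ∑ g, z g • ρ g ≠ 0 := by
  by_contra! hcon
  let ρ : Representation ℂ G (G → ℂ) :=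
    { toFun g :=
        { toFun f x := f (g⁻¹ * x)
          map_add' _ _ := rfl
          map_smul' _ _ := rfl }
      map_one' := by ext; simp
      map_mul' g h := by ext; simp [mul_assoc] }
  refine hz ?_
  classical
  have h := sum_smul_eq_zero_of_isIrreducible z hcon _ ρ rfl
  ext x
  -- In the regular representation, z applied to the delta function at 1 is z itself.
  have h1 := congrFun (LinearMap.congr_fun h (Pi.single 1 1)) x
  simpa [ρ, Pi.single_apply, inv_mul_eq_one] using h1

end Representation


/-! ### Irreducible characters and the degree of their fields -/

namespace IsIrreducibleCharacter

variable {G : Type*} [Group G] [Finite G] {χ ψ : G → ℂ}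

theorem exists_ringEquiv_eq_zpow (hχ : IsIrreducibleCharacter χ) {r : ℤ}
    (hr : IsCoprime r (Nat.card G : ℤ)) : ∃ τ : ℂ ≃+* ℂ, ∀ x, τ (χ x) = χ (x ^ r) := by
  obtain ⟨V, _, _, _, ρ, -, h⟩ := hχ
  obtain ⟨τ, hτ⟩ := exists_complex_ringEquiv_zpow Nat.card_pos.ne' hr
  exact ⟨τ, fun x => by rw [h, h, ρ.ringEquiv_character hτ]⟩

theorem exists_zpow_eq_ringEquiv (hχ : IsIrreducibleCharacter χ) (τ : ℂ ≃+* ℂ) :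
    ∃ r : ℤ, IsCoprime r (Nat.card G : ℤ) ∧ ∀ x, τ (χ x) = χ (x ^ r) := by
  obtain ⟨V, _, _, _, ρ, -, h⟩ := hχ
  obtain ⟨r, hr, hτ⟩ := exists_zpow_of_complex_ringEquiv (Nat.card_pos (α := G)).ne' τ
  exact ⟨r, hr, fun x => by rw [h, h, ρ.ringEquiv_character hτ]⟩

theorem comp_zpow (hχ : IsIrreducibleCharacter χ) {r : ℤ} (hr : IsCoprime r (Nat.card G : ℤ)) :
    IsIrreducibleCharacter fun x => χ (x ^ r) := by
  obtain ⟨V, _, _, _, ρ, _, h⟩ := hχ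
  obtain ⟨τ, hτ⟩ := exists_complex_ringEquiv_zpow Nat.card_pos.ne' hr
  exact ⟨_, _, _, inferInstance, ρ.galoisConj τ, inferInstance, fun x => by
    rw [ρ.character_galoisConj, ρ.ringEquiv_character hτ]; exact h _⟩

omit [Finite G] in
theorem conj (hχ : IsIrreducibleCharacter χ) {x y : G} (h : IsConj x y) : χ x = χ y := by
  obtain ⟨V, _, _, _, ρ, -, hρ⟩ := hχ
  obtain ⟨g, rfl⟩ := isConj_iff.1 h
  rw [hρ, hρ, ρ.char_conj]

open scoped Classical in
theorem orthonormal [Fintype G] (hχ : IsIrreducibleCharacter χ) (hψ : IsIrreducibleCharacter ψ) :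
    (Nat.card G : ℂ)⁻¹ * ∑ g, χ g * ψ g⁻¹ = if χ = ψ then 1 else 0 := by
  obtain ⟨V, _, _, _, ρ, _, hρ⟩ := hχ
  obtain ⟨W, _, _, _, σ, _, hσ⟩ := hψ
  have : Invertible (Nat.card G : ℂ) := invertibleOfNonzero (by exact_mod_cast Nat.card_pos.ne')
  obtain rfl : χ = ρ.character := funext hρ
  obtain rfl : ψ = σ.character := funext hσ
  split_ifs with h
  · rw [← h, Representation.char_orthonormal, if_pos ⟨Representation.Equiv.refl ρ⟩]
  · rw [Representation.char_orthonormal, if_neg fun ⟨e⟩ => h (Representation.char_iso e).symm]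

theorem finiteDimensional_characterField (hχ : IsIrreducibleCharacter χ) :
    FiniteDimensional ℚ (characterField χ) := by
  have : Finite (Set.range χ) := Set.finite_range χ
  refine IntermediateField.finiteDimensional_adjoin fun z hz => ?_
  obtain ⟨x, rfl⟩ := hz
  obtain ⟨V, _, _, _, ρ, -, hρ⟩ := hχ
  rw [hρ]
  exact ρ.isIntegral_character x

omit [Group G] [Finite G] in
theorem characterField_algHom_ext {φ φ' : characterField χ →ₐ[ℚ] ℂ}
    (h : ∀ x (hx : χ x ∈ characterField χ), φ (⟨χ x, hx⟩ : characterField χ) = φ' ⟨χ x, hx⟩) : φ = φ' := by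
  refine IntermediateField.algHom_ext_of_eq_adjoin ℚ (S := characterField χ) rfl ?_
  rintro _ ⟨x, rfl⟩
  exact h x _

/-- A quadratic character field has at most two embeddings in `ℂ`. -/
theorem eq_or_eq_or_eq_of_finrank_le (hχ : IsIrreducibleCharacter χ)
    (h : Module.finrank ℚ (characterField χ) ≤ 2) {r s : ℤ} (hr : IsCoprime r (Nat.card G : ℤ))
    (hs : IsCoprime s (Nat.card G : ℤ)) :
    (∀ x, χ (x ^ r) = χ x) ∨ (∀ x, χ (x ^ s) = χ x) ∨ ∀ x, χ (x ^ r) = χ (x ^ s) := by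
  have := hχ.finiteDimensional_characterField
  obtain ⟨τ, hτ⟩ := hχ.exists_ringEquiv_eq_zpow hr
  obtain ⟨υ, hυ⟩ := hχ.exists_ringEquiv_eq_zpow hs
  let F : (ℂ ≃+* ℂ) → (characterField χ →ₐ[ℚ] ℂ) := fun τ =>
    (τ.toRingHom.comp (algebraMap (characterField χ) ℂ)).toRatAlgHom
  have hF : ∀ τ τ', F τ = F τ' → ∀ x, τ (χ x) = τ' (χ x) := fun τ τ' h x =>
    DFunLike.congr_fun h ⟨χ x, IntermediateField.subset_adjoin _ _ ⟨x, rfl⟩⟩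
  rw [← AlgHom.card ℚ (characterField χ) ℂ] at h
  by_contra! hcon
  obtain ⟨⟨x, hx⟩, ⟨y, hy⟩, ⟨z, hz⟩⟩ := hcon
  -- Otherwise the identity and the conjugations by r and s give three distinct embeddings.
  refine absurd h (not_le.2 (Fintype.two_lt_card_iff.2
    ⟨F (RingEquiv.refl ℂ), F τ, F υ, fun h => ?_, fun h => ?_, fun h => ?_⟩))
  · exact hx ((hτ x).symm.trans (hF _ _ h x).symm)
  · exact hy ((hυ y).symm.trans (hF _ _ h y).symm)
  · exact hz ((hτ z).symm.trans ((hF _ _ h z).trans (hυ z)))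

/-- Every embedding of ℚ(χ) extends to an automorphism of ℂ and so acts through some exponent r. All
exponents on the same side of `P` give the same embedding. -/
theorem finrank_characterField_le (hχ : IsIrreducibleCharacter χ) (P : ℤ → Prop)
    (h₁ : ∀ r s : ℤ, IsCoprime r (Nat.card G : ℤ) → IsCoprime s (Nat.card G : ℤ) → P r → P s →
      ∀ x, χ (x ^ r) = χ (x ^ s))
    (h₂ : ∀ r s : ℤ, IsCoprime r (Nat.card G : ℤ) → IsCoprime s (Nat.card G : ℤ) → ¬ P r → ¬ P s →
      ∀ x, χ (x ^ r) = χ (x ^ s)) : Module.finrank ℚ (characterField χ) ≤ 2 := by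
  have := hχ.finiteDimensional_characterField
  have : Countable (characterField χ) :=
    (Module.finBasis ℚ (characterField χ)).equivFun.injective.countable
  have hemb : ∀ φ : characterField χ →ₐ[ℚ] ℂ, ∃ r : ℤ, IsCoprime r (Nat.card G : ℤ) ∧
      ∀ x (hx : χ x ∈ characterField χ), φ ⟨χ x, hx⟩ = χ (x ^ r) := fun φ => by
    obtain ⟨τ, hτ⟩ := exists_complex_ringEquiv_comp (algebraMap (characterField χ) ℂ) φ.toRingHom
    obtain ⟨r, hr, h⟩ := hχ.exists_zpow_eq_ringEquiv τ
    exact ⟨r, hr, fun x hx => (hτ ⟨χ x, hx⟩).symm.trans (h x)⟩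
  choose r hr hφ using hemb
  rw [← AlgHom.card ℚ (characterField χ) ℂ, ← not_lt]
  intro hlt
  obtain ⟨a, b, c, hab, hac, hbc⟩ := Fintype.two_lt_card_iff.1 hlt
  have key : ∀ a b, (P (r a) ↔ P (r b)) → a = b := fun a b hab => by
    refine characterField_algHom_ext fun x hx => ?_
    rw [hφ a, hφ b]
    by_cases hP : P (r a)
    · exact h₁ _ _ (hr a) (hr b) hP (hab.1 hP) x
    · exact h₂ _ _ (hr a) (hr b) hP (fun h => hP (hab.2 h)) x
  have h1 := mt (key a b) hab
  have h2 := mt (key a c) hac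
  have h3 := mt (key b c) hbc
  tauto

theorem characterField_eq_bot_or_finrank_eq_two_iff (hχ : IsIrreducibleCharacter χ) :
    (characterField χ = ⊥ ∨ Module.finrank ℚ (characterField χ) = 2) ↔
      Module.finrank ℚ (characterField χ) ≤ 2 := by
  have := hχ.finiteDimensional_characterField
  rw [← IntermediateField.finrank_eq_one_iff]
  have : 0 < Module.finrank ℚ (characterField χ) := Module.finrank_pos
  omega

end IsIrreducibleCharacter

/-! ### Uniformly semi-rational groups are quadratic rational -/

/-- Units modulo N surject onto units modulo M. -/
theorem exists_isCoprime_dvd_sub {M N : ℕ} (hN : N ≠ 0) (h : M ∣ N) {m : ℤ}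
    (hm : IsCoprime m (M : ℤ)) : ∃ r : ℤ, IsCoprime r (N : ℤ) ∧ (M : ℤ) ∣ r - m := by
  have : NeZero N := ⟨hN⟩
  obtain ⟨v, hv⟩ := (ZMod.coe_int_isUnit_iff_isCoprime m M).2 hm.symm
  obtain ⟨u, hu⟩ := ZMod.unitsMap_surjective h v
  refine ⟨(u : ZMod N).val, Nat.isCoprime_iff_coprime.2 (ZMod.val_coe_unit_coprime u), ?_⟩
  rw [← ZMod.intCast_zmod_eq_zero_iff_dvd, Int.cast_sub, ← hv, ← hu, Int.cast_natCast,
    ZMod.natCast_val, ZMod.unitsMap_val, sub_self]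

section

variable {G : Type*} [Group G] [Finite G]

omit [Finite G] in
theorem exists_zpow_zpow_eq {r : ℤ} (hr : IsCoprime r (Nat.card G : ℤ)) :
    ∃ s : ℤ, IsCoprime s (Nat.card G : ℤ) ∧ ∀ x : G, (x ^ r) ^ s = x := by
  obtain ⟨s, t, h⟩ := hr
  refine ⟨s, ⟨r, t, by rw [← h]; ring⟩, fun x => ?_⟩
  have : x ^ (Nat.card G : ℤ) = 1 := by rw [zpow_natCast, pow_card_eq_one']
  rw [← zpow_mul, show r * s = 1 - Nat.card G * t by rw [← h]; ring, zpow_sub, zpow_one, zpow_mul,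
    this, one_zpow, inv_one, mul_one]

omit [Finite G] in
theorem zpowers_zpow_eq_of_isCoprime {r : ℤ} (hr : IsCoprime r (Nat.card G : ℤ)) (x : G) :
    Subgroup.zpowers (x ^ r) = Subgroup.zpowers x := by
  obtain ⟨s, -, hs⟩ := exists_zpow_zpow_eq (G := G) hr
  refine le_antisymm ?_ ?_ <;> rw [Subgroup.zpowers_le]
  · exact ⟨r, rfl⟩
  · exact ⟨s, hs x⟩

/-- The exponent of a uniformly semi-rational group can be chosen coprime to the group order. -/
theorem IsUniformlySemiRationalGroup.exists_isCoprime (hG : IsUniformlySemiRationalGroup G) :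
    ∃ r : ℤ, IsCoprime r (Nat.card G : ℤ) ∧ ∀ s : ℤ, IsCoprime s (Nat.card G : ℤ) →
      ∀ x : G, IsConj x (x ^ s) ∨ IsConj (x ^ r) (x ^ s) := by
  classical
  obtain ⟨m, hm⟩ := hG
  have := Fintype.ofFinite G
  -- m matters only for x in `A`, where x ^ m generates ⟨x⟩. It is a unit modulo the lcm of these
  -- orders and lifts to a unit r modulo |G|.
  let A : Finset G := Finset.univ.filter fun x => IsCoprime m (orderOf x : ℤ)
  let M : ℕ := A.lcm orderOf
  have hM : IsCoprime m (M : ℤ) := by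
    suffices ∀ B : Finset G, B ⊆ A → IsCoprime m ((B.lcm orderOf : ℕ) : ℤ) from this A subset_rfl
    intro B
    induction B using Finset.induction_on with
    | empty => intro; simpa using isCoprime_one_right
    | insert x B hx ih =>
      intro hB
      rw [Finset.lcm_insert]
      refine (IsCoprime.mul_right (Finset.mem_filter.1 (hB (Finset.mem_insert_self x B))).2
        (ih ((Finset.subset_insert x B).trans hB))).of_isCoprime_of_dvd_right ?_
      exact_mod_cast Nat.lcm_dvd_mul _ _
  have hMdvd : M ∣ Nat.card G := Finset.lcm_dvd fun x _ => orderOf_dvd_natCard x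
  obtain ⟨r, hrG, hr⟩ := exists_isCoprime_dvd_sub Nat.card_pos.ne' hMdvd hM
  refine ⟨r, hrG, fun s hs x => ?_⟩
  rcases hm x (x ^ s) (zpowers_zpow_eq_of_isCoprime hs x) with h | h
  · exact Or.inl h
  · by_cases hx : IsCoprime m (orderOf x : ℤ)
    · have hxM : (orderOf x : ℤ) ∣ M :=
        Int.natCast_dvd_natCast.2 (Finset.dvd_lcm (Finset.mem_filter.2 ⟨Finset.mem_univ x, hx⟩))
      rw [show x ^ r = x ^ m from
        zpow_eq_zpow_iff_modEq.2 (Int.modEq_iff_dvd.2 (hxM.trans hr)).symm]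
      exact Or.inr h
    -- A conjugate of a generator of ⟨x⟩ has the order of x, so x ^ m would generate ⟨x⟩ and m would
    -- be prime to that order.
    · refine absurd ?_ hx
      have h1 : orderOf (x ^ m) = orderOf x := by
        obtain ⟨c, hc⟩ := h
        rw [hc.orderOf_eq, ← Nat.card_zpowers, ← Nat.card_zpowers,
          zpowers_zpow_eq_of_isCoprime hs x]
      have h2 : Subgroup.zpowers (x ^ m) = Subgroup.zpowers x :=
        Subgroup.eq_of_le_of_card_ge (Subgroup.zpowers_le.2 ⟨m, rfl⟩)
          (by rw [Nat.card_zpowers, Nat.card_zpowers, h1])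
      obtain ⟨t, ht⟩ := Subgroup.mem_zpowers_iff.1 (h2 ▸ Subgroup.mem_zpowers x)
      rw [← zpow_mul] at ht
      nth_rw 2 [← zpow_one x] at ht
      obtain ⟨c, hc⟩ := Int.modEq_iff_dvd.1 (zpow_eq_zpow_iff_modEq.1 ht)
      exact ⟨t, c, by linear_combination -hc⟩

/-- Uniformly semi-rational groups are quadratic rational. -/
theorem IsUniformlySemiRationalGroup.isQuadraticRationalGroup
    (hG : IsUniformlySemiRationalGroup G) : IsQuadraticRationalGroup G := by
  classical
  have := Fintype.ofFinite G
  obtain ⟨r, hr, h⟩ := hG.exists_isCoprime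
  intro χ hχ
  rw [hχ.characterField_eq_bot_or_finrank_eq_two_iff]
  have hconj : ∀ {x y : G} (t : ℤ), IsConj x y → IsConj (x ^ t) (y ^ t) := fun t hxy => by
    obtain ⟨g, rfl⟩ := isConj_iff.1 hxy
    exact isConj_iff.2 ⟨g, by rw [conj_zpow]⟩
  obtain ⟨r', hr', hrr'⟩ := exists_zpow_zpow_eq (G := G) hr
  have hsq : ∀ x : G, IsConj x ((x ^ r) ^ r) := fun x => by
    rcases h (r * r) (hr.mul_left hr) x with h1 | h1 <;> rw [zpow_mul] at h1
    · exact h1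
    · have h2 := hconj r' h1
      rw [hrr', hrr'] at h2
      exact h2.trans h1
  have hsum : ∀ s : ℤ, IsCoprime s (Nat.card G : ℤ) → ∀ x,
      χ (x ^ s) + χ (x ^ (s * r)) = χ x + χ (x ^ r) := fun s hs x => by
    rw [zpow_mul]
    rcases h s hs x with h1 | h1
    · rw [← hχ.conj h1, ← hχ.conj (hconj r h1)]
    · rw [← hχ.conj h1, ← hχ.conj (hconj r h1), ← hχ.conj (hsq x), add_comm]
  have hcases : ∀ s : ℤ, IsCoprime s (Nat.card G : ℤ) →
      (∀ x, χ (x ^ s) = χ x) ∨ ∀ x, χ (x ^ (s * r)) = χ x := fun s hs => by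
    by_contra hcon
    rw [not_or] at hcon
    have h1 := (hχ.comp_zpow hs).orthonormal hχ
    have h2 := (hχ.comp_zpow (hs.mul_left hr)).orthonormal hχ
    have h3 := (hχ.comp_zpow hr).orthonormal hχ
    have h4 := hχ.orthonormal hχ
    rw [if_neg fun h => hcon.1 (congrFun h)] at h1
    rw [if_neg fun h => hcon.2 (congrFun h)] at h2
    rw [if_pos rfl] at h4
    have h5 : (Nat.card G : ℂ)⁻¹ * ∑ g, χ (g ^ s) * χ g⁻¹ +
        (Nat.card G : ℂ)⁻¹ * ∑ g, χ (g ^ (s * r)) * χ g⁻¹ =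
        (Nat.card G : ℂ)⁻¹ * ∑ g, χ g * χ g⁻¹ +
        (Nat.card G : ℂ)⁻¹ * ∑ g, χ (g ^ r) * χ g⁻¹ := by
      simp only [← mul_add, ← Finset.sum_add_distrib, ← add_mul, hsum s hs]
    -- Pairing the identity `hsum` with χ gives 0 on the left and 1 or 2 on the right.
    rw [h1, h2, h3, h4] at h5
    split_ifs at h5 <;> norm_num at h5
  refine hχ.finrank_characterField_le (fun s => ∀ x, χ (x ^ s) = χ x)
    (fun s t _ _ hs ht x => by rw [hs, ht]) fun s t hs ht hs' ht' x => ?_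
  have h1 := (hcases s hs).resolve_left hs'
  have h2 := (hcases t ht).resolve_left ht'
  have h3 := (h1 (x ^ r')).trans (h2 (x ^ r')).symm
  rwa [← zpow_mul, ← zpow_mul, mul_left_comm, mul_left_comm r', zpow_mul x s, zpow_mul x t,
    mul_comm r', zpow_mul _ r, zpow_mul _ r, hrr', hrr'] at h3

end


/-! ### Irreducible representations over a cyclic normal subgroup -/

namespace Representation

section

variable {G V : Type*} [Group G] [AddCommGroup V] [Module ℂ V] {a b : G}

theorem apply_zpow_of_eq_smul (ρ : Representation ℂ G V) {x y : G} {c : ℂ} (hc : c ≠ 0)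
    (h : ρ x = c • ρ y) (r : ℤ) : ρ (x ^ r) = c ^ r • ρ (y ^ r) := by
  have hinv : ρ x⁻¹ = c⁻¹ • ρ y⁻¹ := by
    have h1 : ρ x⁻¹ * ρ x = 1 := by rw [← map_mul, inv_mul_cancel, map_one]
    have h2 : ρ y * ρ y⁻¹ = 1 := by rw [← map_mul, mul_inv_cancel, map_one]
    calc ρ x⁻¹ = c⁻¹ • (ρ x⁻¹ * (c • ρ y) * ρ y⁻¹) := by
          rw [mul_smul_comm, smul_mul_assoc, mul_assoc, h2, mul_one, inv_smul_smul₀ hc]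
      _ = _ := by rw [← h, h1, one_mul]
  induction r with
  | zero => simp
  | succ n ih => rw [zpow_add_one, map_mul, ih, h, smul_mul_smul_comm, zpow_add_one₀ hc,
      zpow_add_one y, map_mul]
  | pred n ih => rw [zpow_sub_one, map_mul, ih, hinv, smul_mul_smul_comm, zpow_sub_one₀ hc,
      zpow_sub_one y, map_mul]

theorem exists_conj_eq_zpow (hN : (Subgroup.zpowers a).Normal) (g : G) :
    ∃ q : ℤ, g⁻¹ * a * g = a ^ q := by
  obtain ⟨q, hq⟩ := Subgroup.mem_zpowers_iff.1 (hN.conj_mem a (Subgroup.mem_zpowers a) g⁻¹)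
  exact ⟨q, by rw [hq, inv_inv]⟩

theorem apply_eigenvector_conj (ρ : Representation ℂ G V) {g : G} {q : ℤ}
    (hq : g⁻¹ * a * g = a ^ q) (v : V) : ρ a (ρ g v) = ρ g (ρ (a ^ q) v) := by
  rw [← hq, ← Module.End.mul_apply, ← Module.End.mul_apply, ← map_mul, ← map_mul]
  congr 2
  group

/-- An element of a cyclic normal subgroup acts trivially or without nonzero fixed vectors on an
irreducible representation. -/
theorem zpow_eq_one_or_forall_fixed_eq_zero (ρ : Representation ℂ G V) [ρ.IsIrreducible]
    (hN : (Subgroup.zpowers a).Normal) (t : ℤ) :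
    ρ (a ^ t) = 1 ∨ ∀ v, ρ (a ^ t) v = v → v = 0 := by
  let W : Submodule ℂ V := LinearMap.ker (ρ (a ^ t) - 1)
  have hmem : ∀ v, v ∈ W ↔ ρ (a ^ t) v = v := fun v => by
    rw [LinearMap.mem_ker, LinearMap.sub_apply, Module.End.one_apply, sub_eq_zero]
  have hW : ∀ g, ∀ v ∈ W, ρ g v ∈ W := fun g v hv => by
    rw [hmem] at hv ⊢
    obtain ⟨q, hq⟩ := exists_conj_eq_zpow hN g
    have hqt : g⁻¹ * a ^ t * g = (a ^ t) ^ q := by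
      have : g⁻¹ * a ^ t * g = (g⁻¹ * a * g) ^ t := by
        simpa using (conj_zpow (a := g⁻¹) (b := a) (i := t)).symm
      rw [this, hq, ← zpow_mul, ← zpow_mul, mul_comm]
    rw [ρ.apply_eigenvector_conj hqt,
      ρ.apply_zpow_of_eigenvector one_ne_zero (by rw [hv, one_smul]), one_zpow, one_smul]
  rcases IsIrreducible.eq_bot_or_eq_top_of_forall ρ W hW with h | h
  · exact Or.inr fun v hv => (Submodule.mem_bot ℂ).1 (h ▸ (hmem v).2 hv)
  · refine Or.inl (LinearMap.ext fun v => ?_)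
    exact (hmem v).1 (h ▸ Submodule.mem_top)

theorem smul_one_ne_zero (ρ : Representation ℂ G V) [ρ.IsIrreducible] {g : G} {c : ℂ}
    (h : ρ g = c • 1) : c ≠ 0 := by
  rintro rfl
  have := IsIrreducible.nontrivial' ρ
  have h1 : ρ g * ρ g⁻¹ = 1 := by rw [← map_mul, mul_inv_cancel, map_one]
  rw [h, zero_smul, zero_mul] at h1
  exact zero_ne_one h1

theorem zpow_eq_smul_one (ρ : Representation ℂ G V) [ρ.IsIrreducible] {g : G} {c : ℂ}
    (h : ρ g = c • 1) (r : ℤ) : ρ (g ^ r) = c ^ r • 1 := by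
  have := ρ.apply_zpow_of_eq_smul (y := 1) (ρ.smul_one_ne_zero h) (by rw [h, map_one]) r
  rwa [one_zpow, map_one] at this

theorem smul_one_injective (ρ : Representation ℂ G V) [ρ.IsIrreducible] {c d : ℂ}
    (h : c • (1 : Module.End ℂ V) = d • 1) : c = d := by
  have := IsIrreducible.nontrivial' ρ
  exact smul_left_injective ℂ one_ne_zero h

theorem pow_natCard_eq_one_of_eq_smul_one (ρ : Representation ℂ G V) [ρ.IsIrreducible] {g : G}
    {c : ℂ} (h : ρ g = c • 1) : c ^ Nat.card G = 1 := by
  refine ρ.smul_one_injective ?_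
  rw [one_smul, ← zpow_natCast, ← ρ.zpow_eq_smul_one h, zpow_natCast, pow_card_eq_one', map_one]

variable [FiniteDimensional ℂ V]

/-- Let x⁻¹ a x = a ^ q. Either a ^ (q - 1) acts trivially, and ρ x commutes with ρ a, or it has no
nonzero fixed vectors. In that case ρ x sends each eigenspace of ρ a, for μ say, into that for μ ^ q
≠ μ, and the trace is 0. -/
theorem commute_or_character_eq_zero [Finite G] (ρ : Representation ℂ G V) [ρ.IsIrreducible]
    (hN : (Subgroup.zpowers a).Normal) (x : G) :
    Commute (ρ x) (ρ a) ∨ ρ.character x = 0 := by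
  classical
  obtain ⟨q, hq⟩ := exists_conj_eq_zpow hN x
  rcases ρ.zpow_eq_one_or_forall_fixed_eq_zero hN (q - 1) with h | h
  · left
    have : a * x = x * (a ^ (q - 1) * a) := by rw [← zpow_add_one, sub_add_cancel, ← hq]; group
    rw [Commute, SemiconjBy, ← map_mul, ← map_mul, this, map_mul, map_mul, map_mul ρ (a ^ (q - 1)), h, one_mul]
  · right
    have hint := Module.End.isInternal_eigenspace_of_pow_eq_one Nat.card_pos.ne'
      (ρ.pow_natCard_eq_one a)
    refine LinearMap.trace_eq_zero_of_mapsTo_ne hint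
      -- The value μ + 1 is a dummy: the map must move every μ, including those that are not
      -- eigenvalues.
      (fun μ => if μ ^ q = μ then μ + 1 else μ ^ q) (fun μ => ?_) fun μ v hv => ?_
    · split_ifs with h <;> simp [h]
    · by_cases hv0 : v = 0
      · rw [hv0, map_zero]; exact Submodule.zero_mem _
      have hv' := Module.End.mem_eigenspace_iff.1 hv
      have hμ : μ ≠ 0 := fun hμ => by
        have := ρ.pow_natCard_eq_one_of_eigenvector hv0 hv'
        rw [hμ, zero_pow Nat.card_pos.ne'] at this
        exact zero_ne_one this
      have hne : μ ^ q ≠ μ := fun hμq => hv0 (h v (by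
        rw [ρ.apply_zpow_of_eigenvector hμ hv', zpow_sub_one₀ hμ, hμq, mul_inv_cancel₀ hμ,
          one_smul]))
      rw [if_neg hne]
      refine Module.End.mem_eigenspace_iff.2 ?_
      rw [ρ.apply_eigenvector_conj hq, ρ.apply_zpow_of_eigenvector hμ hv', map_smul]

/-- ρ(b ^ j) commutes with ρ a and with powers of ρ b, hence with all of ρ(G), and Schur's lemma
applies. -/
theorem exists_eq_smul_one_of_commute (ρ : Representation ℂ G V) [ρ.IsIrreducible]
    (hgen : ∀ x : G, ∃ i j : ℤ, x = a ^ i * b ^ j) {j : ℤ} (h : Commute (ρ (b ^ j)) (ρ a)) :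
    ∃ c : ℂ, ρ (b ^ j) = c • 1 := by
  refine IsIrreducible.exists_eq_smul_one ρ _ fun g => ?_
  obtain ⟨i, l, rfl⟩ := hgen g
  have h1 : Commute (ρ (b ^ j)) (ρ (b ^ l)) := by
    rw [Commute, SemiconjBy, ← map_mul, ← map_mul, ← zpow_add, ← zpow_add, add_comm]
  have h2 : Commute (ρ (b ^ j)) (ρ (a ^ i)) := by
    have : ∀ g, ρ g = (ρ.toHomUnits g : Module.End ℂ V) := fun g => rfl
    rw [this, this] at h
    rw [this, this, map_zpow _ a]
    exact Commute.units_val_iff.2 ((Commute.units_val_iff.1 h).zpow_right i)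
  rw [map_mul]
  exact h2.mul_right h1

theorem zpow_eq_self_of_character_eq (ρ : Representation ℂ G V) [ρ.IsIrreducible] {g : G} {c : ℂ}
    (h : ρ g = c • 1) {r s : ℤ} (hr : ρ.character (g ^ r) = ρ.character (g ^ s)) :
    c ^ r = c ^ s := by
  have := IsIrreducible.nontrivial' ρ
  rw [character, character, ρ.zpow_eq_smul_one h, ρ.zpow_eq_smul_one h, map_smul, map_smul,
    LinearMap.trace_one, smul_eq_mul, smul_eq_mul] at hr
  exact mul_right_cancel₀ (by exact_mod_cast (Module.finrank_pos (R := ℂ) (M := V)).ne') hr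

/-- If powers of `b` can only act by the scalars `±1`, the character is fixed by every exponent `r`
such that `a ^ r` is conjugate to `a`. -/
theorem character_zpow_eq_of_isConj [Finite G] (ρ : Representation ℂ G V) [ρ.IsIrreducible]
    (hN : (Subgroup.zpowers a).Normal) (hgen : ∀ x : G, ∃ i j : ℤ, x = a ^ i * b ^ j)
    (hreal : ∀ (j : ℤ) (c : ℂ), ρ (b ^ j) = c • 1 → c = 1 ∨ c = -1) {r : ℤ}
    (hr : IsCoprime r (Nat.card G : ℤ)) (hconj : IsConj a (a ^ r)) (x : G) :
    ρ.character (x ^ r) = ρ.character x := by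
  by_cases hx : Commute (ρ x) (ρ a)
  · obtain ⟨i, j, rfl⟩ := hgen x
    have hj : Commute (ρ (b ^ j)) (ρ a) := by
      have : ρ (b ^ j) = ρ (a ^ (-i)) * ρ (a ^ i * b ^ j) := by rw [← map_mul]; simp
      rw [this]
      refine Commute.mul_left ?_ hx
      rw [Commute, SemiconjBy, ← map_mul, ← map_mul, ← zpow_add_one, ← zpow_one_add, add_comm]
    obtain ⟨c, hc⟩ := ρ.exists_eq_smul_one_of_commute hgen hj
    have hxc : ρ (a ^ i * b ^ j) = c • ρ (a ^ i) := by
      rw [map_mul, hc, mul_smul_comm, mul_one]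
    have hcr : c ^ r = c := by
      rcases hreal j c hc with rfl | rfl
      · exact one_zpow r
      -- The scalar -1 forces |G| to be even, so r is odd.
      · have h1 := ρ.pow_natCard_eq_one_of_eq_smul_one hc
        have h2 : Even (Nat.card G) := by
          rwa [neg_one_pow_eq_one_iff_even (by norm_num)] at h1
        have h3 : Odd r := by
          rw [← Int.not_even_iff_odd]
          intro h4
          have h5 := hr.isUnit_of_dvd' h4.two_dvd (by exact_mod_cast h2.two_dvd)
          exact absurd (Int.isUnit_iff.1 h5) (by norm_num)
        exact h3.neg_one_zpow
    rw [character, character, ρ.apply_zpow_of_eq_smul (ρ.smul_one_ne_zero hc) hxc, hxc, hcr,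
      map_smul, map_smul]
    congr 1
    obtain ⟨g, hg⟩ := isConj_iff.1 hconj
    have : (a ^ i) ^ r = g * a ^ i * g⁻¹ := by
      rw [← conj_zpow, hg, ← zpow_mul, ← zpow_mul, mul_comm]
    rw [this]
    exact ρ.char_conj _ _
  · rw [(ρ.commute_or_character_eq_zero hN x).resolve_left hx]
    refine (ρ.commute_or_character_eq_zero hN _).resolve_left fun h => hx ?_
    obtain ⟨s, -, hs⟩ := exists_zpow_zpow_eq (G := G) hr
    obtain ⟨n, hn⟩ := (mem_powers_iff_mem_zpowers.2 ⟨s, hs x⟩ : x ∈ Submonoid.powers (x ^ r))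
    rw [← hn, map_pow]
    exact h.pow_left n

end

end Representation

/-! ### Orders of scalars in quadratic rational groups -/

theorem IsQuadraticRationalGroup.eq_or_eq_or_eq {G : Type*} [Group G] [Finite G]
    (hG : IsQuadraticRationalGroup G) {χ : G → ℂ} (hχ : IsIrreducibleCharacter χ) {r s : ℤ}
    (hr : IsCoprime r (Nat.card G : ℤ)) (hs : IsCoprime s (Nat.card G : ℤ)) :
    (∀ x, χ (x ^ r) = χ x) ∨ (∀ x, χ (x ^ s) = χ x) ∨ ∀ x, χ (x ^ r) = χ (x ^ s) :=
  hχ.eq_or_eq_or_eq_of_finrank_le (hχ.characterField_eq_bot_or_finrank_eq_two_iff.1 (hG χ hχ)) hr hs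

/-- The moduli all of whose coprime residues are `±1`. -/
theorem eq_of_forall_isCoprime_dvd {o : ℕ} (ho : o ≠ 0)
    (h : ∀ r : ℤ, IsCoprime r (o : ℤ) → (o : ℤ) ∣ r - 1 ∨ (o : ℤ) ∣ 2 ∨ (o : ℤ) ∣ r + 1) :
    o = 1 ∨ o = 2 ∨ o = 3 ∨ o = 4 ∨ o = 6 := by
  have hle : ∀ m : ℕ, m ≠ 0 → (o : ℤ) ∣ m → o ≤ m := fun m hm hd =>
    Nat.le_of_dvd (Nat.pos_of_ne_zero hm) (by exact_mod_cast hd)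
  -- The test residues are 2 for odd o, o/2 + 1 for 4 ∣ o and o/2 + 2 otherwise: prime to o, and ±1
  -- modulo o only for small o.
  obtain ⟨u, hu | hu | hu⟩ : ∃ u : ℕ, o = 2 * u + 1 ∨ o = 4 * u ∨ o = 4 * u + 2 := by
    rcases (by omega : o % 2 = 1 ∨ o % 4 = 0 ∨ o % 4 = 2) with h | h | h
    · exact ⟨o / 2, by omega⟩
    · exact ⟨o / 4, by omega⟩
    · exact ⟨o / 4, by omega⟩
  · have := h 2 ⟨-u, 1, by rw [hu]; push_cast; ring⟩
    rcases this with h | h | h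
    · have := hle 1 one_ne_zero (by norm_num at h ⊢; exact h); omega
    · have := hle 2 two_ne_zero (by exact_mod_cast h); omega
    · have := hle 3 three_ne_zero (by exact_mod_cast h); omega
  · have := h (2 * u + 1) ⟨1 - 2 * u, u, by rw [hu]; push_cast; ring⟩
    rcases this with h | h | h
    · have := hle (2 * u) (by omega) (by push_cast; simpa using h); omega
    · have := hle 2 two_ne_zero (by exact_mod_cast h); omega
    · have := hle (2 * u + 2) (by omega) (by push_cast; convert h using 1; ring); omega
  · have := h (2 * u + 3) (by
      have h1 : IsCoprime (2 * u + 3 : ℤ) 2 := ⟨1, -(u + 1), by ring⟩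
      have h2 : IsCoprime (2 * u + 3 : ℤ) (2 * u + 1) := ⟨-u, u + 1, by ring⟩
      convert h1.mul_right h2 using 1
      rw [hu]; push_cast; ring)
    rcases this with h | h | h
    · have := hle (2 * u + 2) (by omega) (by push_cast; convert h using 1; ring); omega
    · have := hle 2 two_ne_zero (by exact_mod_cast h); omega
    · have := hle (2 * u + 4) (by omega) (by push_cast; convert h using 1; ring); omega

/-- Scalars in the image of an irreducible representation of a quadratic rational group. -/
theorem IsQuadraticRationalGroup.orderOf_scalar {G : Type*} [Group G] [Finite G]
    (hG : IsQuadraticRationalGroup G) {V : Type} [AddCommGroup V] [Module ℂ V]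
    [FiniteDimensional ℂ V] (ρ : Representation ℂ G V) [ρ.IsIrreducible] {g : G} {c : ℂ}
    (hc : ρ g = c • 1) :
    orderOf c = 1 ∨ orderOf c = 2 ∨ orderOf c = 3 ∨ orderOf c = 4 ∨ orderOf c = 6 := by
  have hpow := ρ.pow_natCard_eq_one_of_eq_smul_one hc
  have hdvd : orderOf c ∣ Nat.card G := orderOf_dvd_of_pow_eq_one hpow
  have hc0 := ρ.smul_one_ne_zero hc
  have hz : ∀ m : ℤ, c ^ m = 1 → (orderOf c : ℤ) ∣ m := fun m hm => by
    have h1 : (Units.mk0 c hc0) ^ m = 1 := by ext; simpa using hm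
    have h2 := orderOf_dvd_iff_zpow_eq_one.2 h1
    rwa [← orderOf_units, Units.val_mk0] at h2
  refine eq_of_forall_isCoprime_dvd (ne_zero_of_dvd_ne_zero Nat.card_pos.ne' hdvd) fun r hr => ?_
  -- The exponent must be prime to |G| to act on characters. It is then compared with -1, which
  -- gives the three alternatives.
  obtain ⟨s, hs, k, hk⟩ := exists_isCoprime_dvd_sub Nat.card_pos.ne' hdvd hr
  have h1 : ∀ m : ℤ, (orderOf c : ℤ) ∣ s - m → (orderOf c : ℤ) ∣ r - m := fun m hm => by
    have := hm.sub ⟨k, hk⟩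
    rwa [sub_sub_sub_cancel_left] at this
  have hquot : ∀ i j : ℤ, c ^ i = c ^ j → (orderOf c : ℤ) ∣ i - j := fun i j h => hz _ (by
    rw [zpow_sub₀ hc0, h, div_self (zpow_ne_zero _ hc0)])
  have hχ : IsIrreducibleCharacter ρ.character :=
    ⟨V, _, _, inferInstance, ρ, inferInstance, fun _ => rfl⟩
  rcases hG.eq_or_eq_or_eq hχ hs (isCoprime_one_left.neg_left : IsCoprime (-1 : ℤ) _)
    with h | h | h
  · refine Or.inl (h1 1 (hquot _ _ (ρ.zpow_eq_self_of_character_eq hc ?_)))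
    rw [h, zpow_one]
  · refine Or.inr (Or.inl ?_)
    have := hquot 1 (-1) (ρ.zpow_eq_self_of_character_eq hc (by rw [h, zpow_one]))
    norm_num at this
    exact this
  · refine Or.inr (Or.inr ?_)
    have := h1 (-1) (hquot _ _ (ρ.zpow_eq_self_of_character_eq hc (h g)))
    rwa [sub_neg_eq_add] at this


/-! ### A character over a faithful character of the normal subgroup -/

theorem exists_isIrreducibleCharacter_forall_isConj {G : Type*} [Group G] [Finite G] {a : G}
    (hN : (Subgroup.zpowers a).Normal) : ∃ χ : G → ℂ, IsIrreducibleCharacter χ ∧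
      ∀ r : ℤ, IsCoprime r (Nat.card G : ℤ) → (∀ x, χ (x ^ r) = χ x) → IsConj a (a ^ r) := by
  classical
  have := Fintype.ofFinite G
  set n := orderOf a with hn
  have hn0 : n ≠ 0 := (orderOf_pos a).ne'
  have hα := Complex.isPrimitiveRoot_exp n hn0
  set α := Complex.exp (2 * Real.pi * Complex.I / n)
  have hα0 : α ≠ 0 := hα.ne_zero hn0
  have hαG : α ^ Nat.card G = 1 := (hα.pow_eq_one_iff_dvd _).2 (orderOf_dvd_natCard a)
  -- n times the idempotent of the faithful character a ↦ α of ⟨a⟩; it acts as n times the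
  -- projection onto the α-eigenspace of ρ a.
  let z : G → ℂ := fun g => ∑ i ∈ Finset.range n, if a ^ i = g then (α⁻¹) ^ i else 0
  have hz : z ≠ 0 := fun h => by
    have h1 : z 1 = 1 := by
      change (∑ i ∈ Finset.range n, if a ^ i = 1 then (α⁻¹) ^ i else 0) = 1
      rw [Finset.sum_eq_single_of_mem 0 (Finset.mem_range.2 (Nat.pos_of_ne_zero hn0))]
      · simp
      · intro i hi hi0
        rw [if_neg fun h => hi0 (Nat.eq_zero_of_dvd_of_lt (orderOf_dvd_of_pow_eq_one h)
          (Finset.mem_range.1 hi))]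
    rw [h] at h1
    exact zero_ne_one h1
  obtain ⟨V, _, _, _, ρ, _, hP⟩ := Representation.exists_isIrreducible_sum_ne_zero z hz
  let P : ℂ → Module.End ℂ V := fun β => ∑ i ∈ Finset.range n, (β⁻¹) ^ i • ρ (a ^ i)
  have hPz : ∑ g, z g • ρ g = P α := by
    simp only [z, P, Finset.sum_smul]
    rw [Finset.sum_comm]
    refine Finset.sum_congr rfl fun i _ => ?_
    simp [ite_smul]
  rw [hPz] at hP
  have hPpow : ∀ i : ℕ, ρ (a ^ i) * P α = α ^ i • P α := by
    have h1 : ρ a * P α = α • P α := by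
      have hT : P α = ∑ i ∈ Finset.range n, (α⁻¹ • ρ a) ^ i :=
        Finset.sum_congr rfl fun i _ => by rw [smul_pow, map_pow]
      have hTn : (α⁻¹ • ρ a) ^ n = 1 := by
        rw [smul_pow, ← map_pow, hn, pow_orderOf_eq_one, ← hn, inv_pow, hα.pow_eq_one, inv_one,
          one_smul, map_one]
      have hTP : (α⁻¹ • ρ a) * P α = P α := by
        have h2 := (geom_sum_succ (x := α⁻¹ • ρ a) (n := n)).symm.trans geom_sum_succ'
        rw [hTn, ← hT, add_comm] at h2
        exact add_left_cancel h2
      rw [← hTP, smul_mul_assoc, smul_smul, mul_inv_cancel₀ hα0, one_smul, ← smul_mul_assoc,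
        hTP]
    intro i
    induction i with
    | zero => simp
    | succ i ih => rw [pow_succ, map_mul, mul_assoc, h1, mul_smul_comm, ih, smul_smul, pow_succ']
  have hPP : P α * P α = (n : ℂ) • P α := by
    conv_lhs => enter [1]; simp only [P]
    rw [Finset.sum_mul]
    simp only [smul_mul_assoc, hPpow, smul_smul, ← mul_pow, inv_mul_cancel₀ hα0, one_pow, one_smul]
    rw [Finset.sum_const, Finset.card_range, Nat.cast_smul_eq_nsmul]
  have htr : LinearMap.trace ℂ V (P α) ≠ 0 := fun h => by
    have hn' : (n : ℂ) ≠ 0 := by exact_mod_cast hn0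
    have hidem : IsIdempotentElem ((n : ℂ)⁻¹ • P α) := by
      rw [IsIdempotentElem, smul_mul_smul_comm, hPP, smul_smul, mul_assoc, inv_mul_cancel₀ hn',
        mul_one]
    have h1 := LinearMap.IsIdempotentElem.eq_zero_of_trace_eq_zero hidem
      (by rw [map_smul, h, smul_zero])
    exact hP ((smul_eq_zero.1 h1).resolve_left (inv_ne_zero hn'))
  refine ⟨ρ.character, ⟨V, _, _, inferInstance, ρ, inferInstance, fun _ => rfl⟩,
    fun r hr hχ => ?_⟩
  by_contra hcon
  obtain ⟨τ, hτ⟩ := exists_complex_ringEquiv_zpow Nat.card_pos.ne' hr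
  have htrace : ∀ β, LinearMap.trace ℂ V (P β) =
      ∑ i ∈ Finset.range n, (β⁻¹) ^ i * ρ.character (a ^ i) := fun β => by
    simp [P, Representation.character]
  -- Since r fixes the character, τ carries the trace at α to the trace at α ^ r.
  have htr' : LinearMap.trace ℂ V (P (α ^ r)) ≠ 0 := by
    have : LinearMap.trace ℂ V (P (α ^ r)) = τ (LinearMap.trace ℂ V (P α)) := by
      rw [htrace, htrace, map_sum]
      refine Finset.sum_congr rfl fun i _ => ?_
      rw [map_mul, map_pow, map_inv₀, hτ α hαG, ρ.ringEquiv_character hτ, hχ]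
    rw [this]
    exact (map_ne_zero τ).2 htr
  obtain ⟨u, hu⟩ : ∃ u, P α u ≠ 0 := by
    by_contra! h
    exact hP (LinearMap.ext h)
  have hw : ρ a (P α u) = α • P α u := by
    have := LinearMap.congr_fun (hPpow 1) u
    simpa using this
  -- Translates of an α-eigenvector are eigenvectors for α ^ q with a ^ q conjugate to a. As α is
  -- faithful, α ^ q = α ^ r would make a ^ r conjugate to a; otherwise the geometric sum vanishes.
  have hkill : ∀ g, P (α ^ r) (ρ g (P α u)) = 0 := fun g => by
    obtain ⟨q, hq⟩ := Representation.exists_conj_eq_zpow hN g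
    have h1 : ρ a (ρ g (P α u)) = α ^ q • ρ g (P α u) := by
      rw [ρ.apply_eigenvector_conj hq, ρ.apply_zpow_of_eigenvector hα0 hw, map_smul]
    have h2 : ∀ i : ℕ, ρ (a ^ i) (ρ g (P α u)) = (α ^ q) ^ i • ρ g (P α u) := fun i => by
      have := ρ.apply_zpow_of_eigenvector (zpow_ne_zero q hα0) h1 i
      rwa [zpow_natCast, zpow_natCast] at this
    have h3 : (α ^ r)⁻¹ * α ^ q ≠ 1 := fun h => by
      refine hcon ?_
      have h4 : α ^ (q - r) = 1 := by rw [zpow_sub₀ hα0, div_eq_inv_mul, h]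
      have h5 : a ^ (q - r) = 1 :=
        orderOf_dvd_iff_zpow_eq_one.1 ((hα.zpow_eq_one_iff_dvd _).1 h4)
      rw [zpow_sub, mul_inv_eq_one] at h5
      rw [← h5, ← hq]
      exact isConj_iff.2 ⟨g⁻¹, by rw [inv_inv]⟩
    have h6 : ((α ^ r)⁻¹ * α ^ q) ^ n = 1 := by
      rw [mul_pow, inv_pow, ← zpow_natCast, ← zpow_natCast, ← zpow_mul, ← zpow_mul, mul_comm r,
        mul_comm q, zpow_mul, zpow_mul, zpow_natCast, hα.pow_eq_one, one_zpow, one_zpow, inv_one,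
        one_mul]
    have h7 : P (α ^ r) (ρ g (P α u)) =
        ∑ i ∈ Finset.range n, ((α ^ r)⁻¹) ^ i • ρ (a ^ i) (ρ g (P α u)) :=
      LinearMap.sum_apply _ _ _
    rw [h7]
    change ∑ i ∈ Finset.range n, ((α ^ r)⁻¹) ^ i • ρ (a ^ i) (ρ g (P α u)) = 0
    simp only [h2, smul_smul, ← mul_pow]
    rw [← Finset.sum_smul, geom_sum_eq h3, h6, sub_self, zero_div, zero_smul]
  let W : Submodule ℂ V := ⨅ g, LinearMap.ker (P (α ^ r) * ρ g)
  have hmem : ∀ v, v ∈ W ↔ ∀ g, P (α ^ r) (ρ g v) = 0 := fun v => by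
    simp [W, Submodule.mem_iInf]
  have hW : W = ⊤ := by
    refine (Representation.IsIrreducible.eq_bot_or_eq_top_of_forall ρ W fun g v hv => ?_).resolve_left
      fun h => hu ((Submodule.mem_bot ℂ).1 (h ▸ (hmem _).2 hkill))
    rw [hmem] at hv ⊢
    intro h
    rw [← Module.End.mul_apply (ρ h), ← map_mul]
    exact hv _
  refine htr' ?_
  have : P (α ^ r) = 0 := LinearMap.ext fun v => by
    simpa using (hmem v).1 (hW ▸ Submodule.mem_top) 1
  rw [this, map_zero]

/-! ### Conjugacy of powers of a, and the exclusion of scalars of orders 3 and 4 together -/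

section

variable {G : Type*} [Group G] [Finite G] {a b : G}

omit [Finite G] in
theorem isConj_zpow_mul_of_isConj {r s : ℤ} (hr : IsConj a (a ^ r)) (hs : IsConj a (a ^ s)) :
    IsConj a (a ^ (r * s)) := by
  obtain ⟨g, hg⟩ := isConj_iff.1 hr
  refine hs.trans (isConj_iff.2 ⟨g, ?_⟩)
  rw [← conj_zpow, hg, zpow_mul]

/-- The exponents `r` with `a ^ r` conjugate to `a` have index at most two. -/
theorem IsQuadraticRationalGroup.isConj_zpow_mul (hG : IsQuadraticRationalGroup G)
    (hN : (Subgroup.zpowers a).Normal) {r s : ℤ} (hr : IsCoprime r (Nat.card G : ℤ))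
    (hs : IsCoprime s (Nat.card G : ℤ)) (hr' : ¬ IsConj a (a ^ r)) (hs' : ¬ IsConj a (a ^ s)) :
    IsConj a (a ^ (r * s)) := by
  obtain ⟨χ, hχ, h⟩ := exists_isIrreducibleCharacter_forall_isConj hN
  refine h _ (hr.mul_left hs) fun x => ?_
  have hr1 := mt (h r hr) hr'
  have hs1 := mt (h s hs) hs'
  have h1 := ((hG.eq_or_eq_or_eq hχ hr hs).resolve_left hr1).resolve_left hs1
  obtain ⟨r', -, hrr'⟩ := exists_zpow_zpow_eq (G := G) hr
  -- With at most two conjugates, r * r must fix χ, and r and s act alike.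
  rcases hG.eq_or_eq_or_eq hχ hr (hr.mul_left hr) with h2 | h2 | h2
  · exact absurd h2 hr1
  · rw [zpow_mul, ← h1, ← zpow_mul, h2]
  · refine absurd (fun y => ?_) hr1
    have := h2 (y ^ r')
    rw [zpow_mul, ← zpow_mul, mul_comm, zpow_mul, hrr'] at this
    exact this.symm

-- The quotient by ⟨a⟩ is cyclic, generated by the image of b; its linear characters inflate to G.
omit [Finite G] in
theorem exists_linearCharacter (hN : (Subgroup.zpowers a).Normal)
    (hgen : ∀ x : G, ∃ i j : ℤ, x = a ^ i * b ^ j) {ω : ℂˣ}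
    (hω : orderOf ω ∣ orderOf (b : G ⧸ Subgroup.zpowers a)) : ∃ θ : G →* ℂˣ, θ b = ω := by
  have hb : ∀ x : G ⧸ Subgroup.zpowers a, x ∈ Subgroup.zpowers (b : G ⧸ Subgroup.zpowers a) := by
    intro x
    obtain ⟨x, rfl⟩ := QuotientGroup.mk_surjective x
    obtain ⟨i, j, rfl⟩ := hgen x
    refine ⟨j, ?_⟩
    have : ((a ^ i : G) : G ⧸ Subgroup.zpowers a) = 1 :=
      (QuotientGroup.eq_one_iff _).2 ⟨i, rfl⟩
    rw [QuotientGroup.mk_mul, this, one_mul]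
    rfl
  exact ⟨(monoidHomOfForallMemZpowers hb hω).comp (QuotientGroup.mk' _),
    monoidHomOfForallMemZpowers_apply_gen hb hω⟩

theorem IsQuadraticRationalGroup.orderOf_linearCharacter (hG : IsQuadraticRationalGroup G)
    (θ : G →* ℂˣ) (g : G) : orderOf (θ g) = 1 ∨ orderOf (θ g) = 2 ∨ orderOf (θ g) = 3 ∨
      orderOf (θ g) = 4 ∨ orderOf (θ g) = 6 := by
  have : (1 : Representation ℂ G ℂ).IsIrreducible :=
    Representation.isIrreducible_of_forall _ fun W _ => eq_bot_or_eq_top W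
  rw [← orderOf_units]
  exact hG.orderOf_scalar ((1 : Representation ℂ G ℂ).twist θ) (g := g) rfl

/-- If `a` is conjugate to its inverse, scalars of order `4` and `3` do not both occur. -/
theorem IsQuadraticRationalGroup.false_of_orderOf_scalar (hG : IsQuadraticRationalGroup G)
    (hN : (Subgroup.zpowers a).Normal) (hgen : ∀ x : G, ∃ i j : ℤ, x = a ^ i * b ^ j)
    (hinv : IsConj a a⁻¹) {V W : Type} [AddCommGroup V] [Module ℂ V] [FiniteDimensional ℂ V]
    [AddCommGroup W] [Module ℂ W] [FiniteDimensional ℂ W] (ρ : Representation ℂ G V)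
    (σ : Representation ℂ G W) [ρ.IsIrreducible] [σ.IsIrreducible] {j l : ℤ} {c d : ℂ}
    (hc : ρ (b ^ j) = c • 1) (hd : σ (b ^ l) = d • 1) (hc4 : orderOf c = 4) (hd3 : orderOf d = 3) :
    False := by
  set k := orderOf (b : G ⧸ Subgroup.zpowers a) with hk
  have hk0 : k ≠ 0 := (orderOf_pos _).ne'
  -- `b ^ k` is a power of `a`
  obtain ⟨t, ht⟩ : ∃ t : ℤ, a ^ t = b ^ k :=
    Subgroup.mem_zpowers_iff.1 ((QuotientGroup.eq_one_iff _).1 (pow_orderOf_eq_one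
      (b : G ⧸ Subgroup.zpowers a)))
  obtain ⟨m, hm⟩ : ∃ m : ℤ, b ^ m * a * (b ^ m)⁻¹ = a⁻¹ := by
    obtain ⟨g, hg⟩ := isConj_iff.1 hinv
    obtain ⟨i, m, rfl⟩ := hgen g
    refine ⟨m, ?_⟩
    calc b ^ m * a * (b ^ m)⁻¹ = (a ^ i)⁻¹ * (a ^ i * b ^ m * a * (a ^ i * b ^ m)⁻¹) * a ^ i := by
          group
      _ = a⁻¹ := by rw [hg]; group
  -- b ^ m inverts b ^ k, a power of a, but also commutes with it.
  have hb2k : b ^ (2 * k) = 1 := by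
    have h1 : b ^ m * a ^ t * (b ^ m)⁻¹ = (a ^ t)⁻¹ := by
      rw [← conj_zpow, hm, inv_zpow]
    have h2 : b ^ m * b ^ k * (b ^ m)⁻¹ = b ^ k := by
      rw [← zpow_natCast, ← zpow_add, add_comm, zpow_add, mul_inv_cancel_right]
    rw [ht, h2] at h1
    rw [two_mul, pow_add, ← eq_inv_iff_mul_eq_one]
    exact h1
  -- The orders 4 and 3 divide 2k, so 6 ∣ k; a linear character of order k forces k ≤ 6.
  have hk6 : k = 6 := by
    have h1 : ∀ {U : Type} [AddCommGroup U] [Module ℂ U] [FiniteDimensional ℂ U]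
        (π : Representation ℂ G U) [π.IsIrreducible] {i : ℤ} {e : ℂ}, π (b ^ i) = e • 1 →
        orderOf e ∣ 2 * k := fun {U} _ _ _ π _ i e he => by
      refine orderOf_dvd_of_pow_eq_one (π.smul_one_injective ?_)
      rw [← zpow_natCast, ← π.zpow_eq_smul_one he, one_smul, ← zpow_mul, mul_comm, zpow_mul,
        zpow_natCast, hb2k, one_zpow, map_one]
    have h4 := h1 ρ hc
    have h3 := h1 σ hd
    rw [hc4] at h4
    rw [hd3] at h3
    have hζ := Complex.isPrimitiveRoot_exp k hk0
    have hu := hζ.isUnit_unit hk0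
    obtain ⟨θ, hθ⟩ := exists_linearCharacter hN hgen (dvd_of_eq hu.eq_orderOf.symm)
    have := hG.orderOf_linearCharacter θ b
    rw [hθ, ← hu.eq_orderOf] at this
    omega
  rw [hk6] at hb2k ht
  have hb12 : b ^ (12 : ℤ) = 1 := by exact_mod_cast hb2k
  have hjodd : Odd j := by
    rw [← Int.not_even_iff_odd]
    rintro ⟨i, rfl⟩
    have h1 : c ^ (6 : ℤ) = 1 := by
      refine ρ.smul_one_injective ?_
      rw [← ρ.zpow_eq_smul_one hc, one_smul, ← zpow_mul, show (i + i) * 6 = 12 * i by ring,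
        zpow_mul, hb12, one_zpow, map_one]
    have h2 := orderOf_dvd_of_pow_eq_one (show c ^ 6 = 1 by exact_mod_cast h1)
    rw [hc4] at h2
    omega
  have hcomm6 : ∀ i : ℤ, Commute (ρ (b ^ (6 * i))) (ρ a) := fun i => by
    have h1 : b ^ (6 * i) = a ^ (t * i) := by
      rw [zpow_mul, zpow_mul, ht]; norm_cast
    rw [h1, Commute, SemiconjBy, ← map_mul, ← map_mul, ← zpow_add_one, ← zpow_one_add, add_comm]
  have hcomm3 : ∀ i : ℤ, Commute (ρ (b ^ (3 * i))) (ρ a) := fun i => by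
    rcases Int.even_or_odd i with ⟨i, rfl⟩ | hi
    · have := hcomm6 i
      rwa [show 6 * i = 3 * (i + i) by ring] at this
    -- For odd i, 3i and 3j differ by a multiple of 6, and b ^ (3j) acts as a scalar.
    · obtain ⟨e, he⟩ := hi.sub_odd hjodd
      have h1 : b ^ (3 * i) = (b ^ j) ^ (3 : ℤ) * b ^ (6 * e) := by
        rw [← zpow_mul, ← zpow_add]; congr 1; linear_combination 3 * he
      rw [h1, map_mul, ρ.zpow_eq_smul_one hc]
      exact ((Commute.one_left _).smul_left _).mul_left (hcomm6 e)
  -- b ^ (3m) inverts a, as b ^ m does, yet commutes with ρ a. By the fixed-vector dichotomy ρ a is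
  -- then ±1, so ρ b is a scalar.
  have ha2 : ρ a * ρ a = 1 := by
    have h1 : b ^ (3 * m) * a = a⁻¹ * b ^ (3 * m) := by
      have h2 : b ^ m * a = a⁻¹ * b ^ m := by rw [← hm]; group
      have h3 : b ^ m * a⁻¹ = a * b ^ m := by
        have : b ^ m * a⁻¹ * (b ^ m)⁻¹ = a := by
          rw [← conj_inv, hm, inv_inv]
        rw [← mul_inv_eq_iff_eq_mul]; exact this
      have h4 : b ^ (3 * m) = b ^ m * b ^ m * b ^ m := by
        rw [← zpow_add, ← zpow_add]; congr 1; ring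
      rw [h4, mul_assoc, h2, mul_assoc, ← mul_assoc (b ^ m) a⁻¹, h3, mul_assoc, ← mul_assoc (b ^ m) a,
        h2]
      simp only [mul_assoc]
    have h5 : ρ a * ρ (b ^ (3 * m)) = ρ a⁻¹ * ρ (b ^ (3 * m)) := by
      rw [← (hcomm3 m).eq, ← map_mul, h1, map_mul]
    have h6 : ρ a = ρ a⁻¹ := by
      have := congrArg (· * ρ (b ^ (3 * m))⁻¹) h5
      simpa only [mul_assoc, ← map_mul, mul_inv_cancel, map_one, mul_one] using this
    nth_rw 2 [h6]
    rw [← map_mul, mul_inv_cancel, map_one]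
  have hab : Commute (ρ (b ^ (1 : ℤ))) (ρ a) := by
    rcases ρ.zpow_eq_one_or_forall_fixed_eq_zero hN 1 with h | h <;> rw [zpow_one a] at h
    · rw [h]; exact Commute.one_right _
    · have : ρ a = -1 := LinearMap.ext fun v => by
        have h1 := h (ρ a v + v) (by
          rw [map_add, ← Module.End.mul_apply, ha2, Module.End.one_apply, add_comm])
        exact eq_neg_of_add_eq_zero_left h1
      rw [this]
      exact (Commute.one_right _).neg_right
  obtain ⟨e, he⟩ := ρ.exists_eq_smul_one_of_commute hgen hab
  rw [zpow_one] at he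
  have hej : e ^ j = c := ρ.smul_one_injective (by rw [← ρ.zpow_eq_smul_one he, hc])
  have he0 := ρ.smul_one_ne_zero he
  let e' := Units.mk0 e he0
  have hee' : orderOf e' = orderOf e := by rw [← orderOf_units]; rfl
  have h4dvd : 4 ∣ orderOf e := by
    rw [← hc4]
    have h1 : orderOf (e' ^ j) = orderOf c := by
      rw [← orderOf_units, Units.val_zpow_eq_zpow_val]; exact congrArg orderOf hej
    rw [← h1, ← hee']
    refine orderOf_dvd_of_pow_eq_one ?_
    rw [← zpow_natCast, ← zpow_mul, mul_comm, zpow_mul, zpow_natCast, pow_orderOf_eq_one, one_zpow]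
  have he4 : orderOf e = 4 := by
    have := hG.orderOf_scalar ρ he
    omega
  have hζ := Complex.isPrimitiveRoot_exp 3 three_ne_zero
  have hu := hζ.isUnit_unit three_ne_zero
  obtain ⟨θ, hθ⟩ := exists_linearCharacter hN hgen
    (show orderOf _ ∣ _ by rw [← hu.eq_orderOf, ← hk, hk6]; norm_num)
  -- Twisting by a linear character of order 3 turns the scalar of order 4 into one of order 12.
  have h1 : (ρ.twist θ) b = ((θ b * e' : ℂˣ) : ℂ) • 1 := by
    rw [ρ.twist_apply, he, smul_smul]; rfl
  have h2 := hG.orderOf_scalar (ρ.twist θ) h1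
  have h3 : orderOf (θ b) = 3 := by rw [hθ, ← hu.eq_orderOf]
  rw [orderOf_units, (Commute.all (θ b) e').orderOf_mul_eq_mul_orderOf_of_coprime
    (by rw [h3, hee', he4]; norm_num), h3, hee', he4] at h2
  omega

end


/-! ### From characters to conjugacy, and the choice of the uniform exponent -/

section

variable {G : Type*} [Group G] [Finite G] {a b : G}

/-- Irreducible characters detect conjugacy of powers. -/
theorem isConj_of_forall_isIrreducibleCharacter {x y z w : G}
    (h : ∀ χ : G → ℂ, IsIrreducibleCharacter χ → χ x + χ y = χ z + χ w) :
    IsConj z x ∨ IsConj w x := by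
  classical
  have := Fintype.ofFinite G
  -- A multiple of the class sum of y, acting on an irreducible representation as a scalar of trace
  -- |G| χ(y). By `h`, the combination below acts as zero on all of them.
  let C : G → G → ℂ := fun y g => ((Finset.univ.filter fun h : G => h * y * h⁻¹ = g).card : ℂ)
  have hC : C x + C y - C z - C w = 0 := by
    by_contra hne
    obtain ⟨V, _, _, _, ρ, _, hρ⟩ := Representation.exists_isIrreducible_sum_ne_zero _ hne
    let T : G → Module.End ℂ V := fun y => ∑ h : G, ρ (h * y * h⁻¹)
    have hT : ∀ y, ∑ g, C y g • ρ g = T y := fun y => by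
      have h1 : ∀ g, C y g • ρ g = ∑ h : G, if h * y * h⁻¹ = g then ρ (h * y * h⁻¹) else 0 :=
        fun g => by
          rw [← Finset.sum_filter, Nat.cast_smul_eq_nsmul, ← Finset.sum_const]
          exact Finset.sum_congr rfl fun h hh => by rw [(Finset.mem_filter.1 hh).2]
      simp only [h1]
      rw [Finset.sum_comm]
      simp [T]
    have hcomm : ∀ y g, T y * ρ g = ρ g * T y := fun y g => by
      simp only [T, Finset.mul_sum, Finset.sum_mul, ← map_mul]
      refine Fintype.sum_equiv (Equiv.mulLeft g⁻¹) _ _ fun h => ?_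
      congr 1
      simp [mul_assoc]
    have htr : ∀ y, LinearMap.trace ℂ V (T y) = Fintype.card G * ρ.character y := fun y => by
      have h1 : ∀ h : G, LinearMap.trace ℂ V (ρ (h * y * h⁻¹)) = ρ.character y := fun h =>
        ρ.char_conj y h
      simp only [T, map_sum, h1]
      rw [Finset.sum_const, Finset.card_univ, nsmul_eq_mul]
    have hsum : ∑ g, (C x + C y - C z - C w) g • ρ g = T x + T y - T z - T w := by
      simp only [Pi.sub_apply, Pi.add_apply, sub_smul, add_smul, Finset.sum_sub_distrib,
        Finset.sum_add_distrib, hT]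
    rw [hsum] at hρ
    obtain ⟨c, hc⟩ := Representation.IsIrreducible.exists_eq_smul_one ρ (T x + T y - T z - T w)
      fun g => by simp only [sub_mul, add_mul, mul_sub, mul_add, hcomm]
    have hχ := h ρ.character ⟨V, _, _, inferInstance, ρ, inferInstance, fun _ => rfl⟩
    have h1 := congrArg (LinearMap.trace ℂ V) hc
    rw [map_sub, map_sub, map_add, htr, htr, htr, htr, map_smul, LinearMap.trace_one,
      ← mul_add, hχ, smul_eq_mul] at h1
    have := Representation.IsIrreducible.nontrivial' ρ
    have h2 : (Module.finrank ℂ V : ℂ) ≠ 0 := by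
      exact_mod_cast (Module.finrank_pos (R := ℂ) (M := V)).ne'
    have h3 : c = 0 := by
      refine (mul_eq_zero.1 (h1.symm.trans ?_)).resolve_right h2
      ring
    exact hρ (by rw [hc, h3, zero_smul])
  have h1 := congrFun hC x
  simp only [C, Pi.sub_apply, Pi.add_apply, Pi.zero_apply, sub_sub, sub_eq_zero] at h1
  norm_cast at h1
  by_contra! hcon
  have hempty : ∀ v, ¬ IsConj v x → (Finset.univ.filter fun h : G => h * v * h⁻¹ = x).card = 0 :=
    fun v hv => Finset.card_eq_zero.2 (Finset.filter_eq_empty_iff.2 fun h _ hh =>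
      hv (isConj_iff.2 ⟨h, hh⟩))
  rw [hempty z hcon.1, hempty w hcon.2, add_zero, Nat.add_eq_zero_iff, Finset.card_eq_zero,
    Finset.filter_eq_empty_iff] at h1
  exact h1.1 (Finset.mem_univ 1) (by simp)

/-- A group is uniformly semi-rational if a single exponent realises all Galois conjugates of
irreducible characters. -/
theorem isUniformlySemiRationalGroup_of_forall_character {r : ℤ}
    (h : ∀ χ : G → ℂ, IsIrreducibleCharacter χ → ∀ s : ℤ, IsCoprime s (Nat.card G : ℤ) →
      (∀ x, χ (x ^ s) = χ x) ∨ ∀ x, χ (x ^ s) = χ (x ^ r)) : IsUniformlySemiRationalGroup G := by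
  refine ⟨r, fun x y hy => ?_⟩
  obtain ⟨s, hs, rfl⟩ : ∃ s : ℤ, IsCoprime s (Nat.card G : ℤ) ∧ x ^ s = y := by
    obtain ⟨t, rfl⟩ := Subgroup.mem_zpowers_iff.1 (hy ▸ Subgroup.mem_zpowers y)
    obtain ⟨u, hu⟩ := Subgroup.mem_zpowers_iff.1 (hy ▸ Subgroup.mem_zpowers x)
    rw [← zpow_mul] at hu
    nth_rw 2 [← zpow_one x] at hu
    obtain ⟨c, hc⟩ := Int.modEq_iff_dvd.1 (zpow_eq_zpow_iff_modEq.1 hu)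
    obtain ⟨s, hs, hst⟩ := exists_isCoprime_dvd_sub Nat.card_pos.ne' (orderOf_dvd_natCard x)
      (⟨u, c, by linear_combination -hc⟩ : IsCoprime t (orderOf x : ℤ))
    exact ⟨s, hs, zpow_eq_zpow_iff_modEq.2 (Int.modEq_iff_dvd.2 hst).symm⟩
  -- For every χ, the values at x ^ s and x ^ (s * r) have the same sum as those at x and x ^ r.
  refine isConj_of_forall_isIrreducibleCharacter (y := x ^ (s * r)) fun χ hχ => ?_
  rcases h χ hχ s hs with h1 | h1
  · rw [h1, mul_comm, zpow_mul, h1]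
  · obtain ⟨s', -, hss'⟩ := exists_zpow_zpow_eq (G := G) hs
    have h2 : ∀ y, χ (y ^ (s * s)) = χ y := by
      rcases h χ hχ (s * s) (hs.mul_left hs) with h2 | h2
      · exact h2
      · have h3 : ∀ y, χ (y ^ s) = χ y := fun y => by
          have h4 := (h2 (y ^ s')).trans (h1 (y ^ s')).symm
          have h5 : (y ^ s') ^ s = y := by rw [← zpow_mul, mul_comm, zpow_mul, hss']
          rwa [zpow_mul, h5] at h4
        exact fun y => by rw [zpow_mul, h3, h3]
    rw [zpow_mul, ← h1, ← zpow_mul, h2, h1, add_comm]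

/-- If r moves χ, there is no room for a third conjugate. If r fixes χ, `hr2` rules out scalars of
orders 3 and 4, and of order 6 by squaring. Only ±1 remain, so χ is fixed by every t with a ^ t
conjugate to a; by index at most 2, s or s * r is such a t. -/
theorem IsQuadraticRationalGroup.eq_or_eq_of_exponent (hG : IsQuadraticRationalGroup G)
    (hN : (Subgroup.zpowers a).Normal) (hgen : ∀ x : G, ∃ i j : ℤ, x = a ^ i * b ^ j) {r : ℤ}
    (hr : IsCoprime r (Nat.card G : ℤ))
    (hr1 : (∀ s : ℤ, IsCoprime s (Nat.card G : ℤ) → IsConj a (a ^ s)) ∨ ¬ IsConj a (a ^ r))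
    (hr2 : ∀ (V : Type) [AddCommGroup V] [Module ℂ V] [FiniteDimensional ℂ V]
      (ρ : Representation ℂ G V) [ρ.IsIrreducible] (j : ℤ) (c : ℂ), ρ (b ^ j) = c • 1 →
        orderOf c = 4 ∨ orderOf c = 3 → c ^ r ≠ c)
    {χ : G → ℂ} (hχ : IsIrreducibleCharacter χ) {s : ℤ} (hs : IsCoprime s (Nat.card G : ℤ)) :
    (∀ x, χ (x ^ s) = χ x) ∨ ∀ x, χ (x ^ s) = χ (x ^ r) := by
  rcases hG.eq_or_eq_or_eq hχ hr hs with h | h | h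
  · left
    obtain ⟨V, _, _, _, ρ, _, hρ⟩ := hχ
    obtain rfl : χ = ρ.character := funext hρ
    have hreal : ∀ (j : ℤ) (c : ℂ), ρ (b ^ j) = c • 1 → c = 1 ∨ c = -1 := fun j c hc => by
      have hfix : c ^ r = c := by
        simpa using ρ.zpow_eq_self_of_character_eq hc (s := 1) (by rw [h, zpow_one])
      have h34 := hr2 V ρ j c hc
      have h3 : orderOf c ≠ 6 := fun h6 => by
        refine hr2 V ρ (j * 2) (c ^ 2) ?_ (Or.inr ?_) ?_
        · rw [zpow_mul, ρ.zpow_eq_smul_one hc]; norm_cast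
        · rw [orderOf_pow_of_dvd two_ne_zero (by rw [h6]; norm_num), h6]
        · rw [← zpow_natCast, ← zpow_mul, mul_comm, zpow_mul, hfix]
      have h2 : c ^ 2 = 1 := orderOf_dvd_iff_pow_eq_one.1 (by
        rcases hG.orderOf_scalar ρ hc with h | h | h | h | h
        · rw [h]; norm_num
        · rw [h]
        · exact absurd hfix (h34 (Or.inr h))
        · exact absurd hfix (h34 (Or.inl h))
        · exact absurd h h3)
      exact (sq_eq_sq_iff_eq_or_eq_neg.1 (h2.trans (one_pow 2).symm))
    have hS : ∀ t : ℤ, IsCoprime t (Nat.card G : ℤ) → IsConj a (a ^ t) →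
        ∀ x, ρ.character (x ^ t) = ρ.character x := fun t ht hat x =>
      ρ.character_zpow_eq_of_isConj hN hgen hreal ht hat x
    intro x
    by_cases hsa : IsConj a (a ^ s)
    · exact hS s hs hsa x
    · have hra := hr1.resolve_left fun h => hsa (h s hs)
      rw [← h, ← zpow_mul]
      exact hS _ (hs.mul_left hr) (hG.isConj_zpow_mul hN hs hr hsa hra) x
  · exact Or.inl h
  · exact Or.inr fun x => (h x).symm

theorem zpow_ne_self_of_not_dvd {c : ℂ} {r : ℤ} (hc : c ≠ 0) (h : ¬ (orderOf c : ℤ) ∣ r - 1) :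
    c ^ r ≠ c := fun hcr => h (by
  have h1 : (Units.mk0 c hc) ^ (r - 1) = 1 := by
    ext
    rw [Units.val_zpow_eq_zpow_val, Units.val_mk0, zpow_sub_one₀ hc, hcr, mul_inv_cancel₀ hc,
      Units.val_one]
  have h2 := orderOf_dvd_iff_zpow_eq_one.2 h1
  rwa [← orderOf_units, Units.val_mk0] at h2)

/-- Quadratic rational metacyclic groups are uniformly semi-rational. -/
theorem IsQuadraticRationalGroup.isUniformlySemiRationalGroup (hG : IsQuadraticRationalGroup G)
    (hN : (Subgroup.zpowers a).Normal) (hgen : ∀ x : G, ∃ i j : ℤ, x = a ^ i * b ^ j) :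
    IsUniformlySemiRationalGroup G := by
  suffices ∃ r : ℤ, IsCoprime r (Nat.card G : ℤ) ∧
      ((∀ s : ℤ, IsCoprime s (Nat.card G : ℤ) → IsConj a (a ^ s)) ∨ ¬ IsConj a (a ^ r)) ∧
      ∀ (V : Type) [AddCommGroup V] [Module ℂ V] [FiniteDimensional ℂ V]
        (ρ : Representation ℂ G V) [ρ.IsIrreducible] (j : ℤ) (c : ℂ), ρ (b ^ j) = c • 1 →
          orderOf c = 4 ∨ orderOf c = 3 → ¬ (orderOf c : ℤ) ∣ r - 1 by
    obtain ⟨r, hr, hr1, hr2⟩ := this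
    exact isUniformlySemiRationalGroup_of_forall_character fun χ hχ s hs =>
      hG.eq_or_eq_of_exponent hN hgen hr hr1 (fun V _ _ _ ρ _ j c hc hoc =>
        zpow_ne_self_of_not_dvd (ρ.smul_one_ne_zero hc) (hr2 V ρ j c hc hoc)) hχ hs
  by_cases h1 : (∀ s : ℤ, IsCoprime s (Nat.card G : ℤ) → IsConj a (a ^ s)) ∨
      ¬ IsConj a (a ^ (-1 : ℤ))
  · refine ⟨-1, isCoprime_one_left.neg_left, h1, fun V _ _ _ ρ _ j c _ hoc => ?_⟩
    rcases hoc with h | h <;> rw [h] <;> norm_num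
  rw [not_or, not_not, zpow_neg_one] at h1
  obtain ⟨h1, hinv⟩ := h1
  push Not at h1
  obtain ⟨p, hp, hpa⟩ := h1
  have hpa' : ¬ IsConj a (a ^ (-p)) := fun h => hpa (by
    have := isConj_zpow_mul_of_isConj (r := -1) (s := -p) (by rwa [zpow_neg_one]) h
    rwa [neg_mul_neg, one_mul] at this)
  -- Neither p nor -p conjugates a, and they are not both 1 modulo q because q does not divide 2.
  have hchoice : ∀ q : ℕ, q = 4 ∨ q = 3 → ∃ r : ℤ, IsCoprime r (Nat.card G : ℤ) ∧
      ¬ IsConj a (a ^ r) ∧ ¬ (q : ℤ) ∣ r - 1 := fun q hq => by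
    by_cases hd : (q : ℤ) ∣ p - 1
    · exact ⟨-p, hp.neg_left, hpa', by rcases hq with rfl | rfl <;> omega⟩
    · exact ⟨p, hp, hpa, hd⟩
  by_cases h4 : ∃ (V : Type) (_ : AddCommGroup V) (_ : Module ℂ V) (_ : FiniteDimensional ℂ V)
      (ρ : Representation ℂ G V) (_ : ρ.IsIrreducible) (j : ℤ) (c : ℂ),
      ρ (b ^ j) = c • 1 ∧ orderOf c = 4
  · obtain ⟨V, _, _, _, ρ, _, j, c, hc, hc4⟩ := h4
    obtain ⟨r, hr, hra, hr4⟩ := hchoice 4 (Or.inl rfl)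
    refine ⟨r, hr, Or.inr hra, fun W _ _ _ σ _ l d hd hod => ?_⟩
    rcases hod with h | h
    · rwa [h]
    · exact (hG.false_of_orderOf_scalar hN hgen hinv ρ σ hc hd hc4 h).elim
  · obtain ⟨r, hr, hra, hr3⟩ := hchoice 3 (Or.inr rfl)
    refine ⟨r, hr, Or.inr hra, fun W _ _ _ σ _ l d hd hod => ?_⟩
    rcases hod with h | h
    · exact absurd ⟨W, _, _, inferInstance, σ, inferInstance, l, d, hd, h⟩ h4
    · rwa [h]

omit [Finite G] in
theorem IsMetacyclicGroup.exists_generators (hG : IsMetacyclicGroup G) :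
    ∃ a b : G, (Subgroup.zpowers a).Normal ∧ ∀ x : G, ∃ i j : ℤ, x = a ^ i * b ^ j := by
  obtain ⟨N, hN, ⟨a, ha⟩, ⟨b, hb⟩⟩ := hG
  obtain ⟨b, rfl⟩ := QuotientGroup.mk_surjective b
  have hNa : ∀ x ∈ N, ∃ i : ℤ, (a : G) ^ i = x := fun x hx => by
    obtain ⟨i, hi⟩ := ha ⟨x, hx⟩
    exact ⟨i, congrArg Subtype.val hi⟩
  have hNeq : Subgroup.zpowers (a : G) = N :=
    le_antisymm (Subgroup.zpowers_le.2 a.2) fun x hx => hNa x hx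
  refine ⟨a, b, hNeq.symm ▸ hN, fun x => ?_⟩
  obtain ⟨j, hj⟩ := hb (x : G ⧸ N)
  have hj' : ((b ^ j : G) : G ⧸ N) = x := hj
  obtain ⟨i, hi⟩ := hNa (x * (b ^ j)⁻¹) (by
    rw [← QuotientGroup.eq_one_iff, QuotientGroup.mk_mul, QuotientGroup.mk_inv, hj',
      mul_inv_cancel])
  exact ⟨i, j, by rw [hi, inv_mul_cancel_right]⟩

end

theorem mainTheorem12 (G : Type*) [Group G] [Finite G] (hG : IsMetacyclicGroup G) :
    (IsQuadraticRationalGroup G ↔ IsUniformlySemiRationalGroup G) ∧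
      List.TFAE [IsUniformlySemiRationalGroup G, IsQuadraticRationalGroup G,
        IsQuadraticSemiRationalGroup G] := by
  have h : IsQuadraticRationalGroup G ↔ IsUniformlySemiRationalGroup G := by
    obtain ⟨a, b, hN, hgen⟩ := hG.exists_generators
    exact ⟨fun h => h.isUniformlySemiRationalGroup hN hgen, fun h => h.isQuadraticRationalGroup⟩
  refine ⟨h, ?_⟩
  tfae_have 1 → 3 := fun h1 => ⟨fun x => h1.imp fun m hm => hm x, h.2 h1⟩
  tfae_have 3 → 2 := fun h3 => h3.2
  tfae_have 2 → 1 := h.1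
  tfae_finish
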